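/- Consider the system $x_{k+1}=Ax_k+Bu_k$, $y_k=Cx_k+Du_k$, $z_k=Ex_k+Fu_k$ with real matrices, $x_k\in\mathbb R^{n_x}$, $u_k\in\mathbb R^{n_u}$, $y_k\in\mathbb R^{n_y}$, $z_k\in\mathbb R^{n_z}$, a constraint set $\mathcal Y\subseteq\mathbb R^{n_y}$, a reference $r\in\mathbb R^{n_z}$, $\epsilon\in(0,1)$ and a horizon $N\ge 1$. Let the columns of $G=[G_x^T\;G_u^T\;G_z^T]^T$ be a basis of the kernel of $Z=\begin{bmatrix}A-I&B&0\\E&F&-I\end{bmatrix}$, and put $\bar x_v=G_xv$, $\bar u_v=G_uv$. Assume: 1. $(A,B)$ is stabilizable; 2. $G_z$ is square and invertible (one may normalize $G_z=I$, but this is not needed); 3. $\mathcal Y=\{y: Y_c\,y\le h\}$ is a compact polyhedron with $0\in\operatorname{int}\mathcal Y$; 4. $Q\succeq0$, $(A,Q)$ is detectable, $R\succ0$. Let $P\succeq 0$ be the solution of $P=Q+A^TPA-A^TPB(R+B^TPB)^{-1}B^TPA$, and let $K=(R+B^TPB)^{-1}B^TPA$. Let $\mathcal R_\epsilon=\{v:(CG_x+DG_u)v\in(1-\epsilon)\mathcal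 Y\}$. Let $\mathcal T$ be the set of all $(x,v)$ with $v\in\mathcal R_\epsilon$ such that the solution of $\xi_{i+1}=(A-BK)\xi_i+B(\bar u_v+K\bar x_v)$, $\xi_0=x$, satisfies $(C-DK)\xi_i+D(\bar u_v+K\bar x_v)\in\mathcal Y$ for all $i\ge0$. For $(x,v)$ consider the optimal control problem of minimizing $$\|\xi_N-\bar x_v\|_P^2+\sum_{i=0}^{N-1}\bigl(\|\xi_i-\bar x_v\|_Q^2+\|\mu_i-\bar u_v\|_R^2\bigr),\qquad \|a\|_M^2:=a^TMa,$$ over $\mu=(\mu_0,\dots,\mu_{N-1})$ subject to $\xi_0=x$, $\xi_{i+1}=A\xi_i+B\mu_i$ and $C\xi_i+D\mu_i\in\mathcal Y$ for $0\le i<N$, and $(\xi_N,v)\in\mathcal T$. Let $\Gamma_N$ be the set of $(x,v)$ for which it is feasible, let $\Lambda=\Gamma_N\cap(\mathbb R^{n_x}\times\mathcal R_\epsilon)$, and let $\Pi_x\Lambda$ be the projection of $\Lambda$ onto the $x$ coordinates. Then the optimal control problem has a unique minimizer $\mu^\star(x,v)$ for every $(x,v)\in\Gamma_N$; for every $x\in\Pi_x\Lambda$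 there is a unique $g(x,r)=\arg\min\{\|v-r\|_2^2: v\in\mathcal R_\epsilon,\ (x,v)\in\Gamma_N\}$; and $r$ has a unique Euclidean projection $r^\star$ onto $\mathcal R_\epsilon$. Moreover, for the closed loop $$v_k=g(x_k,r),\qquad x_{k+1}=Ax_k+B\,\mu_0^\star(x_k,v_k),$$ with state $(x_k,v_{k-1})$ at time $k$, the point $(G_xr^\star,r^\star)$ is an asymptotically stable equilibrium (it is an equilibrium, it is Lyapunov stable, and it attracts a neighbourhood of itself), and its domain of attraction, that is, the set of initial states $(x_0,v_{-1})$ from which the closed loop is defined for all time and $(x_k,v_{k-1})\to(G_xr^\star,r^\star)$, is exactly $\Pi_x\Lambda\times\mathbb R^{n_z}$. -/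

import Mathlib

open Matrix Set Filter Topology
open scoped Pointwise

namespace FeasGov

/-! ### Discrete-time dynamics given by a (possibly partially defined) transition relation -/

section Dynamics

variable {α : Type*}

/-- An infinite trajectory of the transition relation `step`. -/
def IsTrajectory (step : α → α → Prop) (p : ℕ → α) : Prop :=
  ∀ k, step (p k) (p (k + 1))

/-- `e` is an equilibrium: its one and only successor is `e` itself. -/
def IsEquilibrium (step : α → α → Prop) (e : α) : Prop :=
  ∀ q, step e q ↔ q = e

variable [TopologicalSpace α]

/-- Lyapunov stability: all states close enough to `e` have a trajectory, and the trajectories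
starting from them stay in a prescribed neighbourhood of `e` for all time. -/
def IsLyapunovStable (step : α → α → Prop) (e : α) : Prop :=
  ∀ U ∈ 𝓝 e, ∃ W ∈ 𝓝 e, ∀ a ∈ W,
    (∃ p, IsTrajectory step p ∧ p 0 = a) ∧
      ∀ p, IsTrajectory step p → p 0 = a → ∀ k, p k ∈ U

/-- The domain of attraction of `e`: the initial states from which the dynamics can be run for all
time and from which every trajectory converges to `e`. -/
def domainOfAttraction (step : α → α → Prop) (e : α) : Set α :=
  {a | (∃ p, IsTrajectory step p ∧ p 0 = a) ∧
    ∀ p, IsTrajectory step p → p 0 = a → Tendsto p atTop (𝓝 e)}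

/-- Asymptotically stable equilibrium: an equilibrium that is Lyapunov stable and attracts a
neighbourhood of itself. -/
def IsAsymptoticallyStable (step : α → α → Prop) (e : α) : Prop :=
  IsEquilibrium step e ∧ IsLyapunovStable step e ∧ domainOfAttraction step e ∈ 𝓝 e

end Dynamics

/-! ### Matrix notions -/

/-- Schur stability: all complex eigenvalues lie in the open unit disk. -/
def IsSchur {n : ℕ} (M : Matrix (Fin n) (Fin n) ℝ) : Prop :=
  ∀ z ∈ spectrum ℂ (M.map (algebraMap ℝ ℂ)), ‖z‖ < 1

/-- `(A, B)` is stabilizable. -/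
def Stabilizable {n m : ℕ} (A : Matrix (Fin n) (Fin n) ℝ) (B : Matrix (Fin n) (Fin m) ℝ) : Prop :=
  ∃ F : Matrix (Fin m) (Fin n) ℝ, IsSchur (A - B * F)

/-- `(A, Q)` is detectable. -/
def Detectable {n m : ℕ} (A : Matrix (Fin n) (Fin n) ℝ) (Q : Matrix (Fin m) (Fin n) ℝ) : Prop :=
  ∃ L : Matrix (Fin n) (Fin m) ℝ, IsSchur (A - L * Q)

/-- The squared weighted norm `‖x‖_M ^ 2 = xᵀ M x`. -/
def wsq {n : ℕ} (M : Matrix (Fin n) (Fin n) ℝ) (x : Fin n → ℝ) : ℝ := x ⬝ᵥ (M *ᵥ x)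

/-- The squared Euclidean norm `‖x‖₂ ^ 2 = xᵀ x`. -/
def nsq {n : ℕ} (x : Fin n → ℝ) : ℝ := x ⬝ᵥ x

/-! ### The system, the model predictive controller and the feasibility governor -/

/-- The raw data: system matrices, a parametrization `(Gx, Gu, Gz)` of the equilibria, the constraint
polyhedron `{y | Yc y ≤ h}`, the tightening `ε`, the prediction horizon and the cost weights. -/
structure Data (nx nu ny nz nc : ℕ) where
  A : Matrix (Fin nx) (Fin nx) ℝ
  B : Matrix (Fin nx) (Fin nu) ℝ
  C : Matrix (Fin ny) (Fin nx) ℝ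
  D : Matrix (Fin ny) (Fin nu) ℝ
  E : Matrix (Fin nz) (Fin nx) ℝ
  F : Matrix (Fin nz) (Fin nu) ℝ
  Gx : Matrix (Fin nx) (Fin nz) ℝ
  Gu : Matrix (Fin nu) (Fin nz) ℝ
  Gz : Matrix (Fin nz) (Fin nz) ℝ
  Yc : Matrix (Fin nc) (Fin ny) ℝ
  h : Fin nc → ℝ
  ε : ℝ
  N : ℕ
  N_pos : 0 < N
  Q : Matrix (Fin nx) (Fin nx) ℝ
  R : Matrix (Fin nu) (Fin nu) ℝ
  P : Matrix (Fin nx) (Fin nx) ℝ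

namespace Data

variable {nx nu ny nz nc : ℕ} (S : Data nx nu ny nz nc)

/-- The matrix `Z = [A - I, B, 0; E, F, -I]`, whose kernel consists of the equilibria `(x, u, z)`. -/
def Z : Matrix (Fin nx ⊕ Fin nz) (Fin nx ⊕ (Fin nu ⊕ Fin nz)) ℝ :=
  fromBlocks (S.A - 1) (fromCols S.B 0) S.E (fromCols S.F (-1))

/-- The matrix `G`, with block rows `Gx`, `Gu`, `Gz`. -/
def G : Matrix (Fin nx ⊕ (Fin nu ⊕ Fin nz)) (Fin nz) ℝ :=
  fromRows S.Gx (fromRows S.Gu S.Gz)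

/-- The columns of `G` form a basis of `ker Z`. -/
def IsEquilibriumBasis : Prop :=
  LinearIndependent ℝ S.G.col ∧ Submodule.span ℝ (range S.G.col) = LinearMap.ker S.Z.mulVecLin

/-- The constraint set. -/
def Y : Set (Fin ny → ℝ) := {y | S.Yc *ᵥ y ≤ S.h}

/-- The strictly steady-state admissible references. -/
def Reps : Set (Fin nz → ℝ) := {v | (S.C * S.Gx + S.D * S.Gu) *ᵥ v ∈ (1 - S.ε) • S.Y}

/-- The LQR gain. -/
noncomputable def K : Matrix (Fin nu) (Fin nx) ℝ :=
  (S.R + S.Bᵀ * S.P * S.B)⁻¹ * (S.Bᵀ * S.P * S.A)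

/-- `P` is the positive semidefinite solution of the discrete algebraic Riccati equation. -/
def IsRiccatiSolution : Prop :=
  S.P.PosSemidef ∧
    S.P = S.Q + S.Aᵀ * S.P * S.A
      - (S.Aᵀ * S.P * S.B) * (S.R + S.Bᵀ * S.P * S.B)⁻¹ * (S.Bᵀ * S.P * S.A)

/-- One step of the system under the terminal law `u = ū_v - K (x - x̄_v)`. -/
noncomputable def termStep (v : Fin nz → ℝ) (x : Fin nx → ℝ) : Fin nx → ℝ :=
  (S.A - S.B * S.K) *ᵥ x + S.B *ᵥ (S.Gu *ᵥ v + S.K *ᵥ (S.Gx *ᵥ v))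

/-- The constrained output under the terminal law. -/
noncomputable def termOut (v : Fin nz → ℝ) (x : Fin nx → ℝ) : Fin ny → ℝ :=
  (S.C - S.D * S.K) *ᵥ x + S.D *ᵥ (S.Gu *ᵥ v + S.K *ᵥ (S.Gx *ᵥ v))

/-- The terminal set: the maximal output admissible set of the system under the terminal law with
constant reference `v`, with the steady-state constraint tightened by the factor `1 - ε`. -/
def T : Set ((Fin nx → ℝ) × (Fin nz → ℝ)) :=
  {p | p.2 ∈ S.Reps ∧ ∀ i : ℕ, S.termOut p.2 ((S.termStep p.2)^[i] p.1) ∈ S.Y}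

/-- The predicted states `ξ_i`, for `i ≤ N`, under the input sequence `μ` (extended by zero to
`i ≥ N`, where it is not used). -/
def pred (x : Fin nx → ℝ) (μ : Fin S.N → Fin nu → ℝ) : ℕ → Fin nx → ℝ
  | 0 => x
  | i + 1 => S.A *ᵥ pred x μ i + S.B *ᵥ (if hi : i < S.N then μ ⟨i, hi⟩ else 0)

/-- The constraints of the optimal control problem. -/
def OCPFeasible (x : Fin nx → ℝ) (v : Fin nz → ℝ) (μ : Fin S.N → Fin nu → ℝ) : Prop :=
  (∀ i : Fin S.N, S.C *ᵥ S.pred x μ i + S.D *ᵥ μ i ∈ S.Y) ∧ (S.pred x μ S.N, v) ∈ S.T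

/-- The cost of the optimal control problem. -/
def OCPCost (x : Fin nx → ℝ) (v : Fin nz → ℝ) (μ : Fin S.N → Fin nu → ℝ) : ℝ :=
  wsq S.P (S.pred x μ S.N - S.Gx *ᵥ v) +
    ∑ i : Fin S.N, (wsq S.Q (S.pred x μ i - S.Gx *ᵥ v) + wsq S.R (μ i - S.Gu *ᵥ v))

/-- `μ` is a minimizer of the optimal control problem. -/
def IsOCPMinimizer (x : Fin nx → ℝ) (v : Fin nz → ℝ) (μ : Fin S.N → Fin nu → ℝ) : Prop :=
  S.OCPFeasible x v μ ∧ ∀ ν, S.OCPFeasible x v ν → S.OCPCost x v μ ≤ S.OCPCost x v ν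

/-- The feasible set of the optimal control problem. -/
def Γ : Set ((Fin nx → ℝ) × (Fin nz → ℝ)) := {p | ∃ μ, S.OCPFeasible p.1 p.2 μ}

/-- The feasible set of the governor. -/
def Λ : Set ((Fin nx → ℝ) × (Fin nz → ℝ)) := S.Γ ∩ (univ ×ˢ S.Reps)

/-- `v` is a Euclidean projection of `r` onto `Reps`. -/
def IsProjection (r v : Fin nz → ℝ) : Prop :=
  v ∈ S.Reps ∧ ∀ w ∈ S.Reps, nsq (v - r) ≤ nsq (w - r)

/-- `v` is an output `g(x, r)` of the governor: a point of `Reps` closest to `r` among those for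
which the optimal control problem at `x` is feasible. -/
def IsGovernorOutput (r : Fin nz → ℝ) (x : Fin nx → ℝ) (v : Fin nz → ℝ) : Prop :=
  (v ∈ S.Reps ∧ (x, v) ∈ S.Γ) ∧ ∀ w ∈ S.Reps, (x, w) ∈ S.Γ → nsq (v - r) ≤ nsq (w - r)

/-- The closed loop. The state at time `k` is `(x_k, v_{k-1})`, and the successor of `(x, w)` is
`(x⁺, v)` with `v = g(x, r)` and `x⁺ = A x + B κ(x, v)`, where `κ(x, v)` is the first entry of the
minimizer of the optimal control problem. There is no successor where these are undefined. -/
def ClosedLoop (r : Fin nz → ℝ) (p q : (Fin nx → ℝ) × (Fin nz → ℝ)) : Prop :=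
  S.IsGovernorOutput r p.1 q.2 ∧
    ∃ μ, S.IsOCPMinimizer p.1 q.2 μ ∧ q.1 = S.A *ᵥ p.1 + S.B *ᵥ μ ⟨0, S.N_pos⟩

end Data

end FeasGov

/-! Completing squares in the Riccati equation (`bellman`, `cost_eq`) turns the cost of a plan into
`‖x - x̄_v‖_P²` plus the weighted squares of its slacks, the deviations of the inputs from the LQR
law. Only the slack cost depends on the inputs, and it is strictly convex in them because `R ≻ 0`.
This gives the unique minimizer; `g(x, r)` and `r*` are projections onto nonempty closed convex
sets.

Since `P` may be singular, the Lyapunov function is not the optimal cost. It is `U = a(x - x̄_v)² +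
γ · slackCost`, where `a` is a norm contracted by the Schur matrix `A - BK`. Dropping the first
input of a plan and appending the terminal law keeps it feasible and removes exactly the first slack
(`exists_shift`), which pays for the effect of that slack on the state. Changing the reference costs
little: the feasible plans form a polyhedron, so by Hoffman's lemma feasible inputs can be chosen
Lipschitz in `(x, v)`. Polyhedrality of the terminal set comes from the tightening by `ε`, which
leaves steady outputs a uniform margin, and from `exists_finite_determination`. The outcome is `U⁺ ≤
ρ U + D ‖v⁺ - v‖²` with `ρ < 1` (`exists_lyapunov`).

The governor pays for the last term. The old reference stays feasible, so the projection inequality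
`governor_move` bounds `‖v⁺ - v‖²` by twice the decrease of `‖v - r‖²`. Hence `U + 2 D ‖v - r‖²`
decreases by at least `(1 - ρ) U`, and `U → 0`. Once `x` is close to `x̄_v`, a small move of `v`
towards `r*` is feasible, so optimality forces `v = r*` (`exists_governor_eq_of_close`): the
reference arrives in finite time and the state follows. Near the equilibrium the closed loop is the
terminal law for `r*`, whence Lyapunov stability. -/

namespace FeasGov

/-! ### Polyhedra -/

section Polyhedra

variable {E F : Type*} [NormedAddCommGroup E] [NormedSpace ℝ E]
  [NormedAddCommGroup F] [NormedSpace ℝ F]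

/-- A polyhedron: the solution set of finitely many affine inequalities. -/
def IsPolyhedral (s : Set E) : Prop :=
  ∃ t : Set ((E →L[ℝ] ℝ) × ℝ), t.Finite ∧ s = {x | ∀ p ∈ t, p.1 x ≤ p.2}

theorem IsPolyhedral.inter {s t : Set E} (hs : IsPolyhedral s) (ht : IsPolyhedral t) :
    IsPolyhedral (s ∩ t) := by
  obtain ⟨a, ha, rfl⟩ := hs
  obtain ⟨b, hb, rfl⟩ := ht
  refine ⟨a ∪ b, ha.union hb, ?_⟩
  ext x
  simp only [mem_inter_iff, mem_ofPred_eq, mem_union]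
  grind

theorem isPolyhedral_univ : IsPolyhedral (univ : Set E) :=
  ⟨∅, finite_empty, by simp⟩

theorem isPolyhedral_iInter_finset {ι : Type*} (u : Finset ι) {s : ι → Set E}
    (hs : ∀ i, IsPolyhedral (s i)) : IsPolyhedral {x | ∀ i ∈ u, x ∈ s i} := by
  classical
  induction u using Finset.induction_on with
  | empty => simpa using isPolyhedral_univ
  | insert a u _ ih =>
    convert (hs a).inter ih using 1
    ext x
    simp

theorem IsPolyhedral.preimage {s : Set F} (hs : IsPolyhedral s) (f : E →L[ℝ] F) :
    IsPolyhedral (f ⁻¹' s) := by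
  obtain ⟨a, ha, rfl⟩ := hs
  refine ⟨(fun p => (p.1.comp f, p.2)) '' a, ha.image _, ?_⟩
  ext x
  simp only [mem_preimage, mem_ofPred_eq, forall_mem_image, ContinuousLinearMap.comp_apply]

theorem IsPolyhedral.isClosed {s : Set E} (hs : IsPolyhedral s) : IsClosed s := by
  obtain ⟨a, -, rfl⟩ := hs
  simp only [ofPred_forall]
  exact isClosed_biInter fun p _ => isClosed_le p.1.continuous continuous_const

theorem IsPolyhedral.convex {s : Set E} (hs : IsPolyhedral s) : Convex ℝ s := by
  obtain ⟨a, -, rfl⟩ := hs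
  simp only [ofPred_forall]
  exact convex_iInter₂ fun p _ => convex_halfSpace_le p.1.toLinearMap.isLinear _

theorem exists_between_of_finite {lo hi : Set ℝ} (hlo : lo.Finite) (hhi : hi.Finite)
    (H : ∀ a ∈ lo, ∀ b ∈ hi, a ≤ b) : ∃ t, (∀ a ∈ lo, a ≤ t) ∧ ∀ b ∈ hi, t ≤ b := by
  rcases lo.eq_empty_or_nonempty with rfl | hne
  · obtain ⟨t, ht⟩ := hhi.bddBelow
    exact ⟨t, by simp, fun b hb => ht hb⟩
  · obtain ⟨t, ht, hmax⟩ := exists_max_image lo id hlo hne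
    exact ⟨t, hmax, fun b hb => H t ht b hb⟩

/-- Fourier-Motzkin elimination of the direction `d`. -/
theorem IsPolyhedral.eliminate {s : Set E} (hs : IsPolyhedral s) (d : E) :
    IsPolyhedral {y | ∃ t : ℝ, y + t • d ∈ s} := by
  obtain ⟨a, ha, rfl⟩ := hs
  refine ⟨{p ∈ a | p.1 d = 0} ∪ image2 (fun p q => ((-(q.1 d)) • p.1 + (p.1 d) • q.1,
    (-(q.1 d)) * p.2 + (p.1 d) * q.2)) {p ∈ a | 0 < p.1 d} {p ∈ a | p.1 d < 0},
    (ha.sep _).union ((ha.sep _).image2 _ (ha.sep _)), ?_⟩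
  ext y
  simp only [mem_ofPred_eq, map_add, map_smul, smul_eq_mul]
  constructor
  · rintro ⟨t, ht⟩ p (⟨hp, hp0⟩ | ⟨p, ⟨hp, hpd⟩, q, ⟨hq, hqd⟩, rfl⟩)
    · simpa [hp0] using ht p hp
    · have h1 := ht p hp
      have h2 := ht q hq
      simp only [_root_.add_apply, _root_.smul_apply, smul_eq_mul]
      nlinarith
  · intro H
    obtain ⟨t, h1, h2⟩ := exists_between_of_finite
      (lo := (fun q : (E →L[ℝ] ℝ) × ℝ => (q.2 - q.1 y) / q.1 d) '' {p ∈ a | p.1 d < 0})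
      (hi := (fun q : (E →L[ℝ] ℝ) × ℝ => (q.2 - q.1 y) / q.1 d) '' {p ∈ a | 0 < p.1 d})
      ((ha.sep _).image _) ((ha.sep _).image _) (by
        rintro _ ⟨q, ⟨hq, hqd⟩, rfl⟩ _ ⟨p, ⟨hp, hpd⟩, rfl⟩
        have := H _ (Or.inr ⟨p, ⟨hp, hpd⟩, q, ⟨hq, hqd⟩, rfl⟩)
        simp only [_root_.add_apply, _root_.smul_apply,
          smul_eq_mul] at this
        simp only
        rw [div_le_iff_of_neg hqd, div_mul_eq_mul_div, div_le_iff₀ hpd]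
        nlinarith)
    refine ⟨t, fun p hp => ?_⟩
    rcases lt_trichotomy (p.1 d) 0 with hd | hd | hd
    · have := h1 _ ⟨p, ⟨hp, hd⟩, rfl⟩
      simp only at this
      rw [div_le_iff_of_neg hd] at this
      linarith
    · simpa [hd] using H p (Or.inl ⟨hp, hd⟩)
    · have := h2 _ ⟨p, ⟨hp, hd⟩, rfl⟩
      simp only at this
      rw [le_div_iff₀ hd] at this
      linarith

/-- If `y` violates a constraint, take the least `t` satisfying all constraints that decrease along
`d`. At the binding one, feasibility of `x` bounds the violation at `y` by a multiple of `‖y - x‖`,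
hence also `t`. The remaining constraints hold at `t` because they hold at `t₀ ≥ t`. -/
theorem exists_lipschitz_shift_of_nonneg {a : Set ((E →L[ℝ] ℝ) × ℝ)} (ha : a.Finite) (d : E) :
    ∃ L : ℝ, 0 ≤ L ∧ ∀ x y : E, ∀ t₀ : ℝ, 0 ≤ t₀ → (∀ p ∈ a, p.1 x ≤ p.2) →
      (∀ p ∈ a, p.1 (y + t₀ • d) ≤ p.2) →
      ∃ t : ℝ, (∀ p ∈ a, p.1 (y + t • d) ≤ p.2) ∧ ‖y + t • d - x‖ ≤ L * ‖y - x‖ := by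
  classical
  -- The sum of these ratios dominates the ratio of whichever constraint turns out to bind;
  -- constraints parallel to `d` contribute `0` by the convention on division.
  set c : (E →L[ℝ] ℝ) × ℝ → ℝ := fun p => ‖p.1‖ / |p.1 d| with hc
  have hc0 : ∀ p, 0 ≤ c p := fun p => by positivity
  refine ⟨1 + (∑ p ∈ ha.toFinset, c p) * ‖d‖,
    by have := Finset.sum_nonneg fun p (_ : p ∈ ha.toFinset) => hc0 p; positivity, ?_⟩
  intro x y t₀ ht₀ hx hy
  simp only [map_add, map_smul, smul_eq_mul] at hy ⊢
  suffices H : ∃ t : ℝ, (∀ p ∈ a, p.1 y + t * p.1 d ≤ p.2) ∧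
      |t| ≤ (∑ p ∈ ha.toFinset, c p) * ‖y - x‖ by
    obtain ⟨t, h1, h2⟩ := H
    refine ⟨t, h1, ?_⟩
    calc ‖y + t • d - x‖ = ‖(y - x) + t • d‖ := by congr 1; abel
      _ ≤ ‖y - x‖ + |t| * ‖d‖ := by
        refine (norm_add_le _ _).trans ?_
        rw [norm_smul, Real.norm_eq_abs]
      _ ≤ ‖y - x‖ + ((∑ p ∈ ha.toFinset, c p) * ‖y - x‖) * ‖d‖ := by gcongr
      _ = _ := by ring
  by_cases hfe : ∀ p ∈ a, p.1 y ≤ p.2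
  · refine ⟨0, by simpa using hfe, ?_⟩
    rw [abs_zero]
    exact mul_nonneg (Finset.sum_nonneg fun p _ => hc0 p) (norm_nonneg _)
  push Not at hfe
  obtain ⟨p₀, hp₀, hp₀'⟩ := hfe
  have hp₀d : p₀.1 d < 0 := by
    by_contra! hcon
    nlinarith [hy p₀ hp₀]
  obtain ⟨q, ⟨hq, hqd⟩, hmax⟩ := exists_max_image {p ∈ a | p.1 d < 0}
    (fun q => (q.2 - q.1 y) / q.1 d) (ha.sep _) ⟨p₀, hp₀, hp₀d⟩
  set t := (q.2 - q.1 y) / q.1 d with ht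
  have ht0 : 0 < t := by
    refine lt_of_lt_of_le ?_ (hmax p₀ ⟨hp₀, hp₀d⟩)
    exact div_pos_of_neg_of_neg (by linarith) hp₀d
  have htt : t ≤ t₀ := by
    rw [ht, div_le_iff_of_neg hqd]
    linarith [hy q hq]
  refine ⟨t, fun p hp => ?_, ?_⟩
  · rcases lt_or_ge (p.1 d) 0 with hd | hd
    · have := hmax p ⟨hp, hd⟩
      rw [div_le_iff_of_neg hd] at this
      linarith
    · nlinarith [hy p hp]
  · rw [abs_of_pos ht0]
    have h1 : t ≤ c q * ‖y - x‖ := by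
      rw [hc]
      simp only
      rw [abs_of_neg hqd, ht, div_mul_eq_mul_div, ← neg_div_neg_eq]
      have h2 : q.1 y - q.1 x ≤ ‖q.1‖ * ‖y - x‖ := by
        rw [← map_sub]
        exact (le_abs_self _).trans (q.1.le_opNorm _)
      have h3 := hx q hq
      exact div_le_div_of_nonneg_right (by linarith) (by linarith)
    refine h1.trans (mul_le_mul_of_nonneg_right ?_ (norm_nonneg _))
    exact Finset.single_le_sum (fun p _ => hc0 p) (ha.mem_toFinset.2 hq)

theorem IsPolyhedral.exists_lipschitz_shift {s : Set E} (hs : IsPolyhedral s) (d : E) :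
    ∃ L : ℝ, 0 ≤ L ∧ ∀ x ∈ s, ∀ y : E, (∃ t : ℝ, y + t • d ∈ s) →
      ∃ t : ℝ, y + t • d ∈ s ∧ ‖y + t • d - x‖ ≤ L * ‖y - x‖ := by
  obtain ⟨a, ha, rfl⟩ := hs
  obtain ⟨L, hL, H⟩ := exists_lipschitz_shift_of_nonneg ha d
  obtain ⟨L', hL', H'⟩ := exists_lipschitz_shift_of_nonneg ha (-d)
  refine ⟨max L L', le_max_of_le_left hL, ?_⟩
  rintro x hx y ⟨t₀, ht₀⟩
  rcases le_total 0 t₀ with h | h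
  · obtain ⟨t, h1, h2⟩ := H x y t₀ h hx ht₀
    exact ⟨t, h1, h2.trans (by gcongr; exact le_max_left _ _)⟩
  · obtain ⟨t, h1, h2⟩ := H' x y (-t₀) (by linarith) hx (by simpa using ht₀)
    rw [smul_neg, ← neg_smul] at h1 h2
    exact ⟨-t, h1, h2.trans (by gcongr; exact le_max_right _ _)⟩

/-- The sum of a polyhedron `s` and a finite-dimensional subspace `V` is a polyhedron, and the
slices of `s` parallel to `V` depend on the base point in a Lipschitz way (Hoffman's lemma). -/
theorem IsPolyhedral.add_submodule {s : Set E} (hs : IsPolyhedral s) {V : Submodule ℝ E}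
    (hV : V.FG) :
    IsPolyhedral {y | ∃ w ∈ V, y + w ∈ s} ∧
    ∃ L : ℝ, 0 ≤ L ∧ ∀ x ∈ s, ∀ y : E, (∃ w ∈ V, y + w ∈ s) →
      ∃ w ∈ V, y + w ∈ s ∧ ‖y + w - x‖ ≤ L * ‖y - x‖ := by
  classical
  obtain ⟨t, rfl⟩ := hV
  induction t using Finset.induction_on generalizing s with
  | empty =>
    refine ⟨by simpa using hs, 1, zero_le_one, fun x hx y hy => ?_⟩
    simp only [Finset.coe_empty, Submodule.span_empty, Submodule.mem_bot, exists_eq_left,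
      add_zero] at hy ⊢
    exact ⟨hy, by simp⟩
  | insert d t _ ih =>
    -- Shifts along `span (insert d t)` into `s` are shifts along `span t` into the elimination of
    -- `d`; the two Lipschitz constants multiply.
    have key : ∀ y : E, (∃ w ∈ Submodule.span ℝ ((insert d t : Finset E) : Set E), y + w ∈ s) ↔
        ∃ w ∈ Submodule.span ℝ (t : Set E), y + w ∈ {y | ∃ c : ℝ, y + c • d ∈ s} := by
      intro y
      simp only [Finset.coe_insert, mem_ofPred_eq]
      constructor
      · rintro ⟨w, hw, hyw⟩
        obtain ⟨c, z, hz, rfl⟩ := Submodule.mem_span_insert.1 hw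
        exact ⟨z, hz, c, by rwa [add_assoc, add_comm z]⟩
      · rintro ⟨z, hz, c, hc⟩
        exact ⟨c • d + z, Submodule.mem_span_insert.2 ⟨c, z, hz, rfl⟩,
          by rwa [add_comm (c • d), ← add_assoc]⟩
    obtain ⟨h1, L, hL, h2⟩ := ih (hs.eliminate d)
    obtain ⟨L', hL', h3⟩ := hs.exists_lipschitz_shift d
    refine ⟨by simpa only [key] using h1, L' * L, by positivity, fun x hx y hy => ?_⟩
    obtain ⟨w, hw, hw1, hw2⟩ := h2 x ⟨0, by simpa using hx⟩ y ((key y).1 hy)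
    obtain ⟨c, hc1, hc2⟩ := h3 x hx (y + w) hw1
    refine ⟨c • d + w, ?_, by rwa [add_comm (c • d), ← add_assoc], ?_⟩
    · rw [Finset.coe_insert]
      exact Submodule.mem_span_insert.2 ⟨c, w, hw, rfl⟩
    · rw [add_comm (c • d), ← add_assoc, mul_assoc]
      exact hc2.trans (by gcongr)

/-- The projection of a polyhedron in a product is a polyhedron, and the fibres depend on the base
point in a Lipschitz way. -/
theorem IsPolyhedral.fiber_lipschitz [FiniteDimensional ℝ F] {s : Set (E × F)}
    (hs : IsPolyhedral s) :
    IsPolyhedral {a | ∃ b, (a, b) ∈ s} ∧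
    ∃ L : ℝ, 0 ≤ L ∧ ∀ a b, (a, b) ∈ s → ∀ a', (∃ b', (a', b') ∈ s) →
      ∃ b', (a', b') ∈ s ∧ ‖b' - b‖ ≤ L * ‖a' - a‖ := by
  -- Fibres are slices parallel to `{0} × F`. Starting the search over `a'` at the old point `b`
  -- makes the base-point distance exactly `‖a' - a‖`.
  have hV : (LinearMap.range (LinearMap.inr ℝ E F)).FG := by
    rw [LinearMap.range_eq_map]
    exact (Module.finite_def.1 inferInstance).map _
  obtain ⟨h1, L, hL, h2⟩ := hs.add_submodule hV
  have key : ∀ (a : E) (b : F), (∃ w ∈ LinearMap.range (LinearMap.inr ℝ E F), (a, b) + w ∈ s) ↔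
      ∃ b', (a, b') ∈ s := by
    intro a b
    constructor
    · rintro ⟨_, ⟨c, rfl⟩, h⟩
      exact ⟨b + c, by simpa using h⟩
    · rintro ⟨b', h⟩
      exact ⟨_, ⟨b' - b, rfl⟩, by simpa using h⟩
  constructor
  · convert h1.preimage (ContinuousLinearMap.inl ℝ E F) using 1
    ext a
    exact (key a 0).symm
  · refine ⟨L, hL, fun a b hab a' ha' => ?_⟩
    obtain ⟨_, ⟨c, rfl⟩, h3, h4⟩ := h2 _ hab (a', b) ((key a' b).2 ha')
    refine ⟨b + c, by simpa using h3, ?_⟩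
    have h5 : ‖((a', b) : E × F) - (a, b)‖ = ‖a' - a‖ := by simp
    rw [h5] at h4
    exact (norm_snd_le _).trans h4

end Polyhedra

/-! ### Quadratic forms -/

section Quadratic

theorem exists_upper_of_homogeneous {E : Type*} [NormedAddCommGroup E] [NormedSpace ℝ E]
    [FiniteDimensional ℝ E] {f : E → ℝ} (hf : Continuous f)
    (hh : ∀ (c : ℝ) x, f (c • x) = c ^ 2 * f x) : ∃ C : ℝ, 0 < C ∧ ∀ x, f x ≤ C * ‖x‖ ^ 2 := by
  obtain ⟨C, hC⟩ := (isCompact_sphere (0 : E) 1).bddAbove_image hf.continuousOn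
  refine ⟨max C 1, by positivity, fun x => ?_⟩
  rcases eq_or_ne x 0 with rfl | hx
  · have := hh 0 0
    simp at this
    simp [this]
  · have hx' : 0 < ‖x‖ := norm_pos_iff.2 hx
    have h1 : f (‖x‖⁻¹ • x) ≤ C := hC ⟨_, by simp [norm_smul, hx'.ne'], rfl⟩
    have h2 : f x = ‖x‖ ^ 2 * f (‖x‖⁻¹ • x) := by
      rw [← hh, smul_smul, mul_inv_cancel₀ hx'.ne', one_smul]
    rw [h2, mul_comm]
    gcongr
    exact h1.trans (le_max_left _ _)

theorem exists_lower_of_homogeneous {E : Type*} [NormedAddCommGroup E] [NormedSpace ℝ E]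
    [FiniteDimensional ℝ E] {f : E → ℝ} (hf : Continuous f)
    (hh : ∀ (c : ℝ) x, f (c • x) = c ^ 2 * f x) (hpos : ∀ x, x ≠ 0 → 0 < f x) :
    ∃ c : ℝ, 0 < c ∧ ∀ x, c * ‖x‖ ^ 2 ≤ f x := by
  have h0 : f 0 = 0 := by simpa using hh 0 0
  rcases (Metric.sphere (0 : E) 1).eq_empty_or_nonempty with he | hne
  · refine ⟨1, one_pos, fun x => ?_⟩
    rcases eq_or_ne x 0 with rfl | hx
    · simp [h0]
    · have : ‖x‖⁻¹ • x ∈ Metric.sphere (0 : E) 1 := by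
        simp [norm_smul, norm_ne_zero_iff.2 hx]
      simp [he] at this
  · obtain ⟨x₀, hx₀, hmin⟩ := (isCompact_sphere (0 : E) 1).exists_isMinOn hne hf.continuousOn
    refine ⟨f x₀, hpos _ (by rintro rfl; simp at hx₀), fun x => ?_⟩
    rcases eq_or_ne x 0 with rfl | hx
    · simp [h0]
    · have hx' : 0 < ‖x‖ := norm_pos_iff.2 hx
      have h1 : f x₀ ≤ f (‖x‖⁻¹ • x) := hmin (by simp [norm_smul, hx'.ne'])
      have h2 : f x = ‖x‖ ^ 2 * f (‖x‖⁻¹ • x) := by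
        rw [← hh, smul_smul, mul_inv_cancel₀ hx'.ne', one_smul]
      rw [h2, mul_comm]
      gcongr

variable {n : ℕ} {M : Matrix (Fin n) (Fin n) ℝ}

theorem continuous_wsq (M : Matrix (Fin n) (Fin n) ℝ) : Continuous (wsq M) := by
  unfold wsq
  fun_prop

theorem wsq_smul (M : Matrix (Fin n) (Fin n) ℝ) (c : ℝ) (x : Fin n → ℝ) :
    wsq M (c • x) = c ^ 2 * wsq M x := by
  simp only [wsq, mulVec_smul, smul_dotProduct, dotProduct_smul, smul_eq_mul]
  ring

theorem wsq_zero (M : Matrix (Fin n) (Fin n) ℝ) : wsq M 0 = 0 := by simp [wsq]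

theorem wsq_add (M : Matrix (Fin n) (Fin n) ℝ) (a b : Fin n → ℝ) :
    wsq M (a + b) = wsq M a + wsq M b + (a ⬝ᵥ M *ᵥ b + b ⬝ᵥ M *ᵥ a) := by
  simp only [wsq, mulVec_add, add_dotProduct, dotProduct_add]
  ring

theorem wsq_sub (M : Matrix (Fin n) (Fin n) ℝ) (a b : Fin n → ℝ) :
    wsq M (a - b) = wsq M a + wsq M b - (a ⬝ᵥ M *ᵥ b + b ⬝ᵥ M *ᵥ a) := by
  simp only [wsq, mulVec_sub, sub_dotProduct, dotProduct_sub]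
  ring

theorem wsq_nonneg (hM : M.PosSemidef) (x : Fin n → ℝ) : 0 ≤ wsq M x := by
  simpa [wsq] using hM.dotProduct_mulVec_nonneg x

theorem wsq_pos (hM : M.PosDef) {x : Fin n → ℝ} (hx : x ≠ 0) : 0 < wsq M x := by
  simpa [wsq] using hM.dotProduct_mulVec_pos hx

theorem mulVec_eq_zero_of_wsq_eq_zero (hM : M.PosSemidef) {x : Fin n → ℝ} (hx : wsq M x = 0) :
    M *ᵥ x = 0 := by
  rw [← hM.dotProduct_mulVec_zero_iff]
  simpa [wsq] using hx

theorem wsq_add_le (hM : M.PosSemidef) {θ : ℝ} (hθ : 0 < θ) (a b : Fin n → ℝ) :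
    wsq M (a + b) ≤ (1 + θ) * wsq M a + (1 + 1 / θ) * wsq M b := by
  have h := wsq_nonneg hM (θ • a - b)
  have h2 : wsq M (θ • a - b) = θ ^ 2 * wsq M a + wsq M b
      - θ * (a ⬝ᵥ M *ᵥ b + b ⬝ᵥ M *ᵥ a) := by
    rw [wsq_sub, wsq_smul]
    simp only [mulVec_smul, smul_dotProduct, dotProduct_smul, smul_eq_mul]
    ring
  rw [wsq_add]
  have h3 : 0 ≤ (1 / θ) * wsq M (θ • a - b) := by positivity
  rw [h2] at h3
  have h4 : (1 / θ) * (θ ^ 2 * wsq M a + wsq M b - θ * (a ⬝ᵥ M *ᵥ b + b ⬝ᵥ M *ᵥ a))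
      = θ * wsq M a + 1 / θ * wsq M b - (a ⬝ᵥ M *ᵥ b + b ⬝ᵥ M *ᵥ a) := by
    field_simp
  linarith

/-- The defect `wsq M (a - b) / 4` gives both uniqueness of minimizers and the quantitative estimate
in `governor_move`. -/
theorem wsq_midpoint (M : Matrix (Fin n) (Fin n) ℝ) (a b : Fin n → ℝ) :
    wsq M ((1 / 2 : ℝ) • (a + b)) = (wsq M a + wsq M b) / 2 - wsq M (a - b) / 4 := by
  rw [wsq_smul, wsq_add, wsq_sub]
  ring

theorem nsq_eq_wsq (x : Fin n → ℝ) : nsq x = wsq 1 x := by simp [nsq, wsq]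

theorem wsq_conj {m : ℕ} (M : Matrix (Fin n) (Fin n) ℝ) (X : Matrix (Fin n) (Fin m) ℝ)
    (x : Fin m → ℝ) : wsq (Xᵀ * M * X) x = wsq M (X *ᵥ x) := by
  rw [wsq, wsq, ← mulVec_mulVec, ← mulVec_mulVec, dotProduct_mulVec, vecMul_transpose]

theorem wsq_matrix_add (M M' : Matrix (Fin n) (Fin n) ℝ) (x : Fin n → ℝ) :
    wsq (M + M') x = wsq M x + wsq M' x := by
  simp [wsq, add_mulVec, dotProduct_add]

end Quadratic

/-! ### Schur stability -/

section Schur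

variable {n : ℕ}

/-- Complex eigenvalues of a real matrix in terms of the real and imaginary part of an
eigenvector. -/
theorem mem_spectrum_map_iff (M : Matrix (Fin n) (Fin n) ℝ) (z : ℂ) :
    z ∈ spectrum ℂ (M.map (algebraMap ℝ ℂ)) ↔ ∃ a b : Fin n → ℝ, (a ≠ 0 ∨ b ≠ 0) ∧
      M *ᵥ a = z.re • a - z.im • b ∧ M *ᵥ b = z.re • b + z.im • a := by
  have key : ∀ w : Fin n → ℂ, (algebraMap ℂ (Matrix (Fin n) (Fin n) ℂ) z
        - M.map (algebraMap ℝ ℂ)) *ᵥ w = 0 ↔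
      (M *ᵥ (fun i => (w i).re) = z.re • (fun i => (w i).re) - z.im • (fun i => (w i).im) ∧
      M *ᵥ (fun i => (w i).im) = z.re • (fun i => (w i).im) + z.im • (fun i => (w i).re)) := by
    intro w
    rw [sub_mulVec, sub_eq_zero, Algebra.algebraMap_eq_smul_one, smul_mulVec, one_mulVec]
    simp only [funext_iff, Pi.smul_apply, Pi.sub_apply, Pi.add_apply, smul_eq_mul,
      ← forall_and]
    refine forall_congr' fun i => ?_
    rw [Complex.ext_iff]
    simp only [mulVec, dotProduct, map_apply, Complex.coe_algebraMap, Complex.re_sum,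
      Complex.im_sum, Complex.mul_re, Complex.mul_im, Complex.ofReal_re, Complex.ofReal_im,
      zero_mul, sub_zero, add_zero]
    constructor <;> rintro ⟨h1, h2⟩ <;> exact ⟨h1.symm, h2.symm⟩
  rw [spectrum.mem_iff, Matrix.isUnit_iff_isUnit_det, isUnit_iff_ne_zero, not_not,
    ← Matrix.exists_mulVec_eq_zero_iff]
  constructor
  · rintro ⟨w, hw, h⟩
    refine ⟨_, _, ?_, (key w).1 h⟩
    by_contra! hcon
    refine hw (funext fun i => Complex.ext ?_ ?_)
    · exact congrFun hcon.1 i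
    · exact congrFun hcon.2 i
  · rintro ⟨a, b, hab, h⟩
    refine ⟨fun i => ⟨a i, b i⟩, ?_, (key _).2 h⟩
    rintro h0
    rcases hab with ha | hb
    · exact ha (funext fun i => congrArg Complex.re (congrFun h0 i))
    · exact hb (funext fun i => congrArg Complex.im (congrFun h0 i))

/-- The pair is the real and imaginary part of `z (a + i b)` for `z = s + i t`, so the associated
Hermitian form is scaled by `|z|²`. -/
theorem wsq_rotate (M : Matrix (Fin n) (Fin n) ℝ) (s t : ℝ) (a b : Fin n → ℝ) :
    wsq M (s • a - t • b) + wsq M (s • b + t • a) = (s ^ 2 + t ^ 2) * (wsq M a + wsq M b) := by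
  rw [wsq_sub, wsq_add]
  simp only [wsq_smul, mulVec_smul, smul_dotProduct, dotProduct_smul, smul_eq_mul]
  ring

/-- A Lyapunov equation with a detectable right-hand side forces Schur stability. -/
theorem isSchur_of_lyapunov {m : ℕ} {A Q P : Matrix (Fin n) (Fin n) ℝ}
    {B : Matrix (Fin n) (Fin m) ℝ} {K : Matrix (Fin m) (Fin n) ℝ} {R : Matrix (Fin m) (Fin m) ℝ}
    (hP : P.PosSemidef) (hQ : Q.PosSemidef) (hR : R.PosDef) (hDet : Detectable A Q)
    (h : ∀ x, wsq P x = wsq Q x + wsq R (K *ᵥ x) + wsq P ((A - B * K) *ᵥ x)) :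
    IsSchur (A - B * K) := by
  intro z hz
  by_contra! hz1
  obtain ⟨L, hL⟩ := hDet
  obtain ⟨a, b, hab, ha, hb⟩ := (mem_spectrum_map_iff _ z).1 hz
  have hnorm : 1 ≤ z.re ^ 2 + z.im ^ 2 := by
    have : ‖z‖ ^ 2 = z.re ^ 2 + z.im ^ 2 := by
      rw [Complex.sq_norm, Complex.normSq_apply]; ring
    nlinarith
  have h1 := h a
  have h2 := h b
  rw [ha] at h1
  rw [hb] at h2
  have h3 := wsq_rotate P z.re z.im a b
  have hPa := wsq_nonneg hP a
  have hPb := wsq_nonneg hP b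
  have hQa := wsq_nonneg hQ a
  have hQb := wsq_nonneg hQ b
  have hRa := wsq_nonneg hR.posSemidef (K *ᵥ a)
  have hRb := wsq_nonneg hR.posSemidef (K *ᵥ b)
  have h4 : wsq P a + wsq P b ≤ (z.re ^ 2 + z.im ^ 2) * (wsq P a + wsq P b) :=
    le_mul_of_one_le_left (by positivity) hnorm
  -- For `|z| ≥ 1` the Lyapunov identity forces the `Q` and `R` terms of the eigenvector to vanish.
  -- There `A - L Q` and `A - B K` agree, so `z` would be an eigenvalue of the Schur matrix `A - L
  -- Q`.
  have key : ∀ x, wsq Q x = 0 → wsq R (K *ᵥ x) = 0 → (A - L * Q) *ᵥ x = (A - B * K) *ᵥ x := by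
    intro x hx1 hx2
    have e1 := mulVec_eq_zero_of_wsq_eq_zero hQ hx1
    have e2 : K *ᵥ x = 0 := by
      by_contra hne
      exact (wsq_pos hR hne).ne' hx2
    rw [sub_mulVec, sub_mulVec, ← mulVec_mulVec, ← mulVec_mulVec, e1, e2, mulVec_zero, mulVec_zero]
  refine absurd (hL z ((mem_spectrum_map_iff _ z).2 ⟨a, b, hab, ?_, ?_⟩)) (not_lt.2 hz1)
  · rw [key a (by linarith) (by linarith), ha]
  · rw [key b (by linarith) (by linarith), hb]

/-- Gelfand's formula for the complexified matrix, with `c` strictly between the spectral radius and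
`1`; the operator norm used is the one induced by the sup norm, which real vectors keep under
complexification. -/
theorem IsSchur.exists_pow_norm_le {M : Matrix (Fin n) (Fin n) ℝ} (hM : IsSchur M) :
    ∃ c : ℝ, 0 < c ∧ c < 1 ∧ ∃ m : ℕ, 0 < m ∧ ∀ x : Fin n → ℝ, ‖(M ^ m) *ᵥ x‖ ≤ c ^ m * ‖x‖ := by
  let := Matrix.linftyOpNormedRing (n := Fin n) (α := ℂ)
  let := Matrix.linftyOpNormedAlgebra (n := Fin n) (R := ℂ) (α := ℂ)
  rcases Nat.eq_zero_or_pos n with rfl | hn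
  · refine ⟨1 / 2, by norm_num, by norm_num, 1, one_pos, fun x => ?_⟩
    rw [Subsingleton.elim x 0, mulVec_zero, norm_zero, mul_zero]
  have : Nonempty (Fin n) := ⟨⟨0, hn⟩⟩
  have : CompleteSpace (Matrix (Fin n) (Fin n) ℂ) := FiniteDimensional.complete ℂ _
  set N := M.map (algebraMap ℝ ℂ) with hN
  have h1 : spectralRadius ℂ N < (1 : NNReal) := by
    refine spectrum.spectralRadius_lt_of_forall_lt N fun k hk => ?_
    have := hM k hk
    rwa [← NNReal.coe_lt_coe]
  obtain ⟨c, hc1, hc2⟩ := ENNReal.lt_iff_exists_nnreal_btwn.1 h1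
  have hc2' : c < 1 := by exact_mod_cast hc2
  have hc0 : 0 < c := by
    have := lt_of_le_of_lt zero_le hc1
    exact_mod_cast this
  have h2 := (spectrum.pow_nnnorm_pow_one_div_tendsto_nhds_spectralRadius N).eventually
    (gt_mem_nhds hc1)
  obtain ⟨m, hm1, hm2⟩ := (h2.and (eventually_gt_atTop 0)).exists
  refine ⟨c, by exact_mod_cast hc0, by exact_mod_cast hc2', m, hm2, fun x => ?_⟩
  have hm3 : ‖N ^ m‖₊ ≤ c ^ m := by
    have hm' : (m : ℝ) ≠ 0 := by positivity
    have h4 := ENNReal.rpow_le_rpow hm1.le (z := (m : ℝ)) (by positivity)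
    rw [← ENNReal.rpow_mul, one_div, inv_mul_cancel₀ hm', ENNReal.rpow_one,
      ENNReal.rpow_natCast] at h4
    exact_mod_cast h4
  have hm4 : ‖N ^ m‖ ≤ (c : ℝ) ^ m := by exact_mod_cast hm3
  have h5 : (N ^ m) *ᵥ (fun i => (x i : ℂ)) = fun i => (((M ^ m) *ᵥ x) i : ℂ) := by
    rw [hN, ← Matrix.map_pow]
    ext i
    simp [mulVec, dotProduct]
  have h6 : ∀ y : Fin n → ℝ, ‖fun i => (y i : ℂ)‖ = ‖y‖ := by
    intro y
    simp [Pi.norm_def]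
  have h7 := Matrix.linfty_opNorm_mulVec (N ^ m) (fun i => (x i : ℂ))
  rw [h5, h6, h6] at h7
  exact h7.trans (by gcongr)

/-- A norm adapted to a Schur matrix, for which it is a contraction. -/
theorem IsSchur.exists_adapted_norm {M : Matrix (Fin n) (Fin n) ℝ} (hM : IsSchur M) :
    ∃ (c : ℝ) (a : (Fin n → ℝ) → ℝ) (C : ℝ), 0 < c ∧ c < 1 ∧ 0 < C ∧ (∀ x, ‖x‖ ≤ a x) ∧
      (∀ x, a x ≤ C * ‖x‖) ∧ (∀ x y, a (x + y) ≤ a x + a y) ∧ ∀ x, a (M *ᵥ x) ≤ c * a x := by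
  obtain ⟨c, hc0, hc1, m, hm, h⟩ := hM.exists_pow_norm_le
  have hb : ∀ i : ℕ, ∃ D : ℝ, 0 ≤ D ∧ ∀ x : Fin n → ℝ, ‖(M ^ i) *ᵥ x‖ ≤ D * ‖x‖ := fun i =>
    ⟨‖LinearMap.toContinuousLinearMap (M ^ i).mulVecLin‖, norm_nonneg _, fun x =>
      (LinearMap.toContinuousLinearMap (M ^ i).mulVecLin).le_opNorm x⟩
  choose D hD0 hD using hb
  -- Applying `M` shifts this sum by one index at the price of a factor `c`; the new last term is at
  -- most the lost first one, by the choice of `m`.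
  refine ⟨c, fun x => ∑ i ∈ Finset.range m, (c⁻¹) ^ i * ‖(M ^ i) *ᵥ x‖,
    1 + ∑ i ∈ Finset.range m, (c⁻¹) ^ i * D i, hc0, hc1, ?_, ?_, ?_, ?_, ?_⟩
  · have : 0 ≤ ∑ i ∈ Finset.range m, (c⁻¹) ^ i * D i :=
      Finset.sum_nonneg fun i _ => mul_nonneg (by positivity) (hD0 i)
    linarith
  · intro x
    have := Finset.single_le_sum (f := fun i => (c⁻¹) ^ i * ‖(M ^ i) *ᵥ x‖)
      (fun i _ => by positivity) (Finset.mem_range.2 hm)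
    simpa using this
  · intro x
    rw [add_mul, one_mul, Finset.sum_mul]
    refine le_add_of_nonneg_of_le (norm_nonneg _) (Finset.sum_le_sum fun i _ => ?_)
    rw [mul_assoc]
    gcongr
    exact hD i x
  · intro x y
    rw [← Finset.sum_add_distrib]
    refine Finset.sum_le_sum fun i _ => ?_
    rw [mulVec_add, ← mul_add]
    gcongr
    exact norm_add_le _ _
  · intro x
    set f : ℕ → ℝ := fun i => (c⁻¹) ^ i * ‖(M ^ i) *ᵥ x‖ with hf
    have h1 : ∀ i, (c⁻¹) ^ i * ‖(M ^ i) *ᵥ (M *ᵥ x)‖ = c * f (i + 1) := by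
      intro i
      rw [hf, mulVec_mulVec, ← pow_succ]
      simp only
      rw [pow_succ (c⁻¹)]
      field_simp
    simp only [h1]
    rw [← Finset.mul_sum]
    refine mul_le_mul_of_nonneg_left ?_ hc0.le
    change _ ≤ ∑ i ∈ Finset.range m, f i
    have h2 : f m ≤ f 0 := by
      simp only [hf, pow_zero, one_mul, one_mulVec]
      rw [inv_pow, inv_mul_le_iff₀ (by positivity)]
      exact h x
    have h3 := Finset.sum_range_succ f m
    have h4 := Finset.sum_range_succ' f m
    linarith

theorem IsSchur.exists_pow_decay {M : Matrix (Fin n) (Fin n) ℝ} (hM : IsSchur M) :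
    ∃ c C : ℝ, 0 < c ∧ c < 1 ∧ 0 < C ∧ ∀ i x, ‖(M ^ i) *ᵥ x‖ ≤ C * c ^ i * ‖x‖ := by
  obtain ⟨c, a, C, hc0, hc1, hC, h1, h2, -, h4⟩ := hM.exists_adapted_norm
  refine ⟨c, C, hc0, hc1, hC, fun i x => ?_⟩
  have h5 : a ((M ^ i) *ᵥ x) ≤ c ^ i * a x := by
    induction i with
    | zero => simp
    | succ i ih =>
      rw [pow_succ', ← mulVec_mulVec, pow_succ', mul_assoc]
      exact (h4 _).trans (by gcongr)
  calc _ ≤ _ := (h1 _).trans h5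
    _ ≤ c ^ i * (C * ‖x‖) := by gcongr; exact h2 x
    _ = _ := by ring

end Schur

/-! ### Finite determination and unique minimizers -/

/-- For linear maps `f j → 0`, a bound on finitely many `f j x` makes all others small. -/
theorem exists_finite_determination {E F : Type*} [NormedAddCommGroup E] [NormedSpace ℝ E]
    [FiniteDimensional ℝ E] [NormedAddCommGroup F] [NormedSpace ℝ F] [FiniteDimensional ℝ F]
    (f : ℕ → E →ₗ[ℝ] F) {b : ℕ → ℝ} (hb : Tendsto b atTop (𝓝 0))
    (hf : ∀ j x, ‖f j x‖ ≤ b j * ‖x‖) (M : ℝ) {η : ℝ} (hη : 0 < η) :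
    ∃ J : ℕ, ∀ x, (∀ j < J, ‖f j x‖ ≤ M) → ∀ j, J ≤ j → ‖f j x‖ ≤ η := by
  -- The common kernels of the first `k` maps decrease, hence stabilize: from some `k` on, vanishing
  -- of the first `k` values makes all of them vanish.
  let ker : ℕ →o (Submodule ℝ E)ᵒᵈ :=
    { toFun := fun k => OrderDual.toDual (⨅ j : Fin k, LinearMap.ker (f j))
      monotone' := fun k l hkl => by
        refine OrderDual.toDual_le_toDual.2 (le_iInf fun j => ?_)
        exact iInf_le (fun j : Fin l => LinearMap.ker (f j)) ⟨j, j.2.trans_le hkl⟩ }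
  obtain ⟨k, hk⟩ := IsArtinian.monotone_stabilizes ker
  have hker : ∀ x, (∀ j < k, f j x = 0) → ∀ j, f j x = 0 := by
    intro x hx j
    have h1 : x ∈ ⨅ j : Fin k, LinearMap.ker (f j) := by
      simp only [Submodule.mem_iInf, LinearMap.mem_ker]
      exact fun i => hx i i.2
    have h2 : (⨅ i : Fin k, LinearMap.ker (f i)) =
        ⨅ i : Fin (max k (j + 1)), LinearMap.ker (f i) := hk _ (le_max_left _ _)
    rw [h2] at h1
    simp only [Submodule.mem_iInf, LinearMap.mem_ker] at h1
    exact h1 ⟨j, by simp⟩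
  let Φ : E →ₗ[ℝ] (Fin k → F) := LinearMap.pi fun j => f j
  -- A linear right inverse of `Φ` on its range replaces `x` by `G (Φ x)`, which has the same values
  -- under every `f j` and whose norm is controlled by the first `k` of them. No injectivity of `Φ`
  -- is needed.
  obtain ⟨g, hg⟩ := Φ.rangeRestrict.exists_rightInverse_of_surjective Φ.range_rangeRestrict
  obtain ⟨G, hG⟩ := LinearMap.exists_extend g
  have hGΦ : ∀ x, Φ (G (Φ x)) = Φ x := by
    intro x
    have h1 : G (Φ x) = g (Φ.rangeRestrict x) := LinearMap.congr_fun hG (Φ.rangeRestrict x)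
    rw [h1]
    exact congrArg Subtype.val (LinearMap.congr_fun hg (Φ.rangeRestrict x))
  have hfG : ∀ j x, f j x = f j (G (Φ x)) := by
    intro j x
    have h1 := hker (x - G (Φ x)) (fun i hi => by
      have := congrFun (hGΦ x) ⟨i, hi⟩
      simp only [Φ, LinearMap.pi_apply] at this
      rw [map_sub, sub_eq_zero]
      exact this.symm) j
    rwa [map_sub, sub_eq_zero] at h1
  set Gc := LinearMap.toContinuousLinearMap G with hGc
  have hlim : Tendsto (fun j => |b j| * (‖Gc‖ * |M|)) atTop (𝓝 0) := by
    simpa using hb.abs.mul_const (‖Gc‖ * |M|)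
  obtain ⟨J, hJ⟩ := eventually_atTop.1 (hlim.eventually (gt_mem_nhds hη))
  refine ⟨max J k, fun x hx j hj => ?_⟩
  have hΦ : ‖Φ x‖ ≤ |M| := by
    rw [pi_norm_le_iff_of_nonneg (abs_nonneg _)]
    exact fun i => (hx i (i.2.trans_le (le_max_right _ _))).trans (le_abs_self _)
  have h1 : ‖G (Φ x)‖ ≤ ‖Gc‖ * |M| :=
    (Gc.le_opNorm (Φ x)).trans (by gcongr)
  rw [hfG]
  calc _ ≤ b j * ‖G (Φ x)‖ := hf _ _
    _ ≤ |b j| * ‖G (Φ x)‖ := by gcongr; exact le_abs_self _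
    _ ≤ |b j| * (‖Gc‖ * |M|) := by gcongr
    _ ≤ η := (hJ j (le_of_max_le_left hj)).le

/-- A continuous coercive function on a closed convex set which is strictly midpoint convex has a
unique minimizer. -/
theorem existsUnique_minimizer {E : Type*} [NormedAddCommGroup E] [NormedSpace ℝ E]
    [FiniteDimensional ℝ E] {s : Set E} (hs : IsClosed s) (hc : Convex ℝ s) (hne : s.Nonempty)
    {f : E → ℝ} (hf : Continuous f) {c : ℝ} (hc0 : 0 < c) {x₀ : E}
    (hcoer : ∀ x, c * ‖x - x₀‖ ^ 2 ≤ f x)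
    (hmid : ∀ x y, x ≠ y → f ((1 / 2 : ℝ) • (x + y)) < (f x + f y) / 2) :
    ∃! x, x ∈ s ∧ ∀ y ∈ s, f x ≤ f y := by
  obtain ⟨z, hz⟩ := hne
  have htend : Tendsto (fun x => c * ‖x - x₀‖ ^ 2) (cocompact E) atTop := by
    refine Tendsto.const_mul_atTop hc0 ((tendsto_pow_atTop two_ne_zero).comp ?_)
    refine (tendsto_norm_cocompact_atTop (E := E)).comp ?_
    exact (Homeomorph.subRight x₀).isClosedEmbedding.tendsto_cocompact
  have hev : ∀ᶠ x in cocompact E, f z ≤ f x := by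
    filter_upwards [htend.eventually_ge_atTop (f z)] with x hx using hx.trans (hcoer x)
  obtain ⟨x, hx, hmin⟩ := hf.continuousOn.exists_isMinOn' hs hz (hev.filter_mono inf_le_left)
  refine ⟨x, ⟨hx, fun y hy => hmin hy⟩, ?_⟩
  rintro y ⟨hy, hy'⟩
  by_contra hyx
  have h1 : (1 / 2 : ℝ) • (y + x) ∈ s := by
    rw [smul_add]
    exact hc hy hx (by norm_num) (by norm_num) (by norm_num)
  have h2 := hmid y x hyx
  have h3 := hy' _ h1
  have h4 := hmin h1
  simp only [mem_ofPred_eq] at h4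
  linarith

theorem existsUnique_nearest {n : ℕ} {s : Set (Fin n → ℝ)} (hs : IsClosed s) (hc : Convex ℝ s)
    (hne : s.Nonempty) (r : Fin n → ℝ) :
    ∃! v, v ∈ s ∧ ∀ w ∈ s, nsq (v - r) ≤ nsq (w - r) := by
  have hcont : Continuous (nsq : (Fin n → ℝ) → ℝ) := by unfold nsq; fun_prop
  obtain ⟨c, hc0, hcl⟩ := exists_lower_of_homogeneous hcont
    (fun c x => by rw [nsq_eq_wsq, nsq_eq_wsq, wsq_smul])
    (fun x hx => by rw [nsq_eq_wsq]; exact wsq_pos Matrix.PosDef.one hx)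
  refine existsUnique_minimizer hs hc hne (f := fun v => nsq (v - r)) (by fun_prop) hc0
    (x₀ := r) (fun x => hcl _) fun x y hxy => ?_
  have h1 : (1 / 2 : ℝ) • (x + y) - r = (1 / 2 : ℝ) • ((x - r) + (y - r)) := by
    ext i; simp; ring
  have h2 : x - r - (y - r) ≠ 0 := by
    rw [sub_sub_sub_cancel_right]; exact sub_ne_zero.2 hxy
  have h3 := wsq_pos (Matrix.PosDef.one (n := Fin n) (R := ℝ)) h2
  simp only [h1, nsq_eq_wsq, wsq_midpoint]
  linarith

/-! ### The cost as a sum of squared deviations from the LQR law -/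

namespace Data

variable {nx nu ny nz nc : ℕ} (S : Data nx nu ny nz nc)

/-- The closed-loop matrix under the LQR gain. -/
noncomputable def closedMatrix : Matrix (Fin nx) (Fin nx) ℝ := S.A - S.B * S.K

/-- The output matrix under the LQR gain. -/
noncomputable def closedOutput : Matrix (Fin ny) (Fin nx) ℝ := S.C - S.D * S.K

/-- The steady-state output map. -/
def steadyOutput : Matrix (Fin ny) (Fin nz) ℝ := S.C * S.Gx + S.D * S.Gu

/-- The weight of the deviation from the LQR law. -/
def slackWeight : Matrix (Fin nu) (Fin nu) ℝ := S.R + S.Bᵀ * S.P * S.B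

/-- The consequences of the standing assumptions on which the analysis is based. -/
structure Regular : Prop where
  eps : S.ε ∈ Ioo (0 : ℝ) 1
  equilibrium : S.A * S.Gx + S.B * S.Gu = S.Gx
  compact : IsCompact S.Y
  interior : (0 : Fin ny → ℝ) ∈ interior S.Y
  Q_nonneg : S.Q.PosSemidef
  R_pos : S.R.PosDef
  riccati : S.IsRiccatiSolution
  detectable : Detectable S.A S.Q

/-- Joint states, references and input sequences. -/
abbrev Plan : Type := ((Fin nx → ℝ) × (Fin nz → ℝ)) × (Fin S.N → Fin nu → ℝ)

/-- The predicted state as a linear map. -/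
noncomputable def predMap : ℕ → S.Plan →ₗ[ℝ] (Fin nx → ℝ)
  | 0 => LinearMap.fst ℝ _ _ ∘ₗ LinearMap.fst ℝ _ _
  | i + 1 => S.A.mulVecLin ∘ₗ predMap i + S.B.mulVecLin ∘ₗ
      (if hi : i < S.N then LinearMap.proj ⟨i, hi⟩ ∘ₗ LinearMap.snd ℝ _ _ else 0)

theorem predMap_apply (i : ℕ) (p : S.Plan) : S.predMap i p = S.pred p.1.1 p.2 i := by
  induction i with
  | zero => rfl
  | succ i ih =>
    simp only [predMap, pred, LinearMap.add_apply, LinearMap.comp_apply, ih, mulVecLin_apply]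
    split_ifs <;> rfl

/-- The deviation of the input from the LQR law. -/
noncomputable def slack (i : Fin S.N) : S.Plan →ₗ[ℝ] (Fin nu → ℝ) :=
  LinearMap.proj (φ := fun _ => Fin nu → ℝ) i ∘ₗ LinearMap.snd ℝ _ _
    - S.Gu.mulVecLin ∘ₗ LinearMap.snd ℝ _ _ ∘ₗ LinearMap.fst ℝ _ _
    + S.K.mulVecLin ∘ₗ (S.predMap i
      - S.Gx.mulVecLin ∘ₗ LinearMap.snd ℝ _ _ ∘ₗ LinearMap.fst ℝ _ _)

theorem slack_apply (i : Fin S.N) (p : S.Plan) : S.slack i p =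
    (p.2 i - S.Gu *ᵥ p.1.2) + S.K *ᵥ (S.pred p.1.1 p.2 i - S.Gx *ᵥ p.1.2) := by
  simp [slack, predMap_apply]

/-- The total weight of the deviations from the LQR law. -/
noncomputable def slackCost (p : S.Plan) : ℝ := ∑ i, wsq S.slackWeight (S.slack i p)

theorem continuous_slackCost : Continuous S.slackCost :=
  continuous_finsetSum _ fun i _ =>
    (continuous_wsq _).comp (S.slack i).continuous_of_finiteDimensional

theorem slackCost_smul (c : ℝ) (p : S.Plan) : S.slackCost (c • p) = c ^ 2 * S.slackCost p := by
  simp [slackCost, wsq_smul, Finset.mul_sum]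

theorem slackCost_midpoint (p p' : S.Plan) : S.slackCost ((1 / 2 : ℝ) • (p + p')) =
    (S.slackCost p + S.slackCost p') / 2 - S.slackCost (p - p') / 4 := by
  simp only [slackCost, map_smul, map_add, map_sub, wsq_midpoint, Finset.sum_sub_distrib,
    ← Finset.sum_div, Finset.sum_add_distrib]

variable {S}

namespace Regular

theorem slackWeight_posDef (hS : S.Regular) : S.slackWeight.PosDef := by
  refine hS.R_pos.add_posSemidef ?_
  simpa using hS.riccati.1.conjTranspose_mul_mul_same S.B

theorem slackWeight_mul_K (hS : S.Regular) : S.slackWeight * S.K = S.Bᵀ * S.P * S.A := by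
  rw [K, ← Matrix.mul_assoc, ← slackWeight, Matrix.mul_nonsing_inv, Matrix.one_mul]
  exact (Matrix.isUnit_iff_isUnit_det _).1 hS.slackWeight_posDef.isUnit

theorem P_transpose (hS : S.Regular) : S.Pᵀ = S.P := by
  simpa [Matrix.IsSymm] using hS.riccati.1.isHermitian

theorem slackWeight_transpose (hS : S.Regular) : S.slackWeightᵀ = S.slackWeight := by
  simpa [Matrix.IsSymm] using hS.slackWeight_posDef.isHermitian

theorem riccati_eq (hS : S.Regular)
    : S.P + S.Kᵀ * S.slackWeight * S.K = S.Q + S.Aᵀ * S.P * S.A := by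
  have h1 : S.Kᵀ * S.slackWeight * S.K
      = (S.Aᵀ * S.P * S.B) * (S.R + S.Bᵀ * S.P * S.B)⁻¹ * (S.Bᵀ * S.P * S.A) := by
    rw [Matrix.mul_assoc, hS.slackWeight_mul_K]
    congr 1
    have h2 : (S.R + S.Bᵀ * S.P * S.B)ᵀ = S.R + S.Bᵀ * S.P * S.B := hS.slackWeight_transpose
    rw [K, transpose_mul, transpose_nonsing_inv, h2]
    simp only [transpose_mul, transpose_transpose, hS.P_transpose, Matrix.mul_assoc]
  rw [h1]
  nth_rewrite 1 [hS.riccati.2]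
  abel

/-- Completion of squares in the Bellman equation of the linear-quadratic regulator. -/
theorem bellman (hS : S.Regular) (e : Fin nx → ℝ) (w : Fin nu → ℝ) :
    wsq S.P (S.A *ᵥ e + S.B *ᵥ w) + (wsq S.Q e + wsq S.R w) =
      wsq S.P e + wsq S.slackWeight (w + S.K *ᵥ e) := by
  have h1 : wsq S.P e + wsq S.slackWeight (S.K *ᵥ e) = wsq S.Q e + wsq S.P (S.A *ᵥ e) := by
    rw [← wsq_conj, ← wsq_conj, ← wsq_matrix_add, ← wsq_matrix_add, hS.riccati_eq]
  have h2 : wsq S.slackWeight w = wsq S.R w + wsq S.P (S.B *ᵥ w) := by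
    rw [slackWeight, wsq_matrix_add, wsq_conj]
  have h3 : w ⬝ᵥ S.slackWeight *ᵥ (S.K *ᵥ e) = (S.B *ᵥ w) ⬝ᵥ S.P *ᵥ (S.A *ᵥ e) := by
    rw [mulVec_mulVec, hS.slackWeight_mul_K, ← mulVec_mulVec, ← mulVec_mulVec,
      dotProduct_mulVec, vecMul_transpose]
  have h4 : (S.K *ᵥ e) ⬝ᵥ S.slackWeight *ᵥ w = w ⬝ᵥ S.slackWeight *ᵥ (S.K *ᵥ e) := by
    rw [dotProduct_comm, ← vecMul_transpose, hS.slackWeight_transpose, ← dotProduct_mulVec]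
  have h5 : (S.A *ᵥ e) ⬝ᵥ S.P *ᵥ (S.B *ᵥ w) = (S.B *ᵥ w) ⬝ᵥ S.P *ᵥ (S.A *ᵥ e) := by
    rw [dotProduct_comm, ← vecMul_transpose, hS.P_transpose, ← dotProduct_mulVec]
  rw [wsq_add, wsq_add, h2, h3, h4, h5]
  rw [h3]
  linarith

theorem isSchur (hS : S.Regular) : IsSchur S.closedMatrix := by
  refine isSchur_of_lyapunov hS.riccati.1 hS.Q_nonneg hS.R_pos hS.detectable fun x => ?_
  have h := hS.bellman x (-(S.K *ᵥ x))
  have h1 : wsq S.R (-(S.K *ᵥ x)) = wsq S.R (S.K *ᵥ x) := by simp [wsq, mulVec_neg]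
  rw [neg_add_cancel, wsq_zero, h1, mulVec_neg, ← sub_eq_add_neg, mulVec_mulVec,
    ← sub_mulVec] at h
  linarith

theorem steady (hS : S.Regular)
    (v : Fin nz → ℝ) : S.A *ᵥ (S.Gx *ᵥ v) + S.B *ᵥ (S.Gu *ᵥ v) = S.Gx *ᵥ v := by
  rw [mulVec_mulVec, mulVec_mulVec, ← add_mulVec, hS.equilibrium]

theorem step_sub (hS : S.Regular) (v : Fin nz → ℝ) (x : Fin nx → ℝ) (u : Fin nu → ℝ) :
    S.A *ᵥ x + S.B *ᵥ u - S.Gx *ᵥ v =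
      S.A *ᵥ (x - S.Gx *ᵥ v) + S.B *ᵥ (u - S.Gu *ᵥ v) := by
  conv_lhs => rw [← hS.steady v]
  rw [mulVec_sub, mulVec_sub]
  abel

theorem step_sub_closed (hS : S.Regular) (v : Fin nz → ℝ) (x : Fin nx → ℝ) (u : Fin nu → ℝ) :
    S.A *ᵥ x + S.B *ᵥ u - S.Gx *ᵥ v = S.closedMatrix *ᵥ (x - S.Gx *ᵥ v) +
      S.B *ᵥ ((u - S.Gu *ᵥ v) + S.K *ᵥ (x - S.Gx *ᵥ v)) := by
  rw [hS.step_sub, closedMatrix, sub_mulVec, ← mulVec_mulVec, mulVec_add]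
  abel

/-- `bellman` telescopes along the prediction, and the terminal weight `P` cancels the last term. -/
theorem cost_eq (hS : S.Regular) (x : Fin nx → ℝ) (v : Fin nz → ℝ) (μ : Fin S.N → Fin nu → ℝ) :
    S.OCPCost x v μ = wsq S.P (x - S.Gx *ᵥ v) + S.slackCost ((x, v), μ) := by
  have h1 : ∀ i : Fin S.N, (wsq S.Q (S.pred x μ i - S.Gx *ᵥ v) + wsq S.R (μ i - S.Gu *ᵥ v))
      - wsq S.slackWeight (S.slack i ((x, v), μ)) = wsq S.P (S.pred x μ i - S.Gx *ᵥ v)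
        - wsq S.P (S.pred x μ (i + 1) - S.Gx *ᵥ v) := by
    intro i
    have h2 : S.pred x μ (i + 1) = S.A *ᵥ S.pred x μ i + S.B *ᵥ μ i := by simp [pred]
    have h3 := hS.bellman (S.pred x μ i - S.Gx *ᵥ v) (μ i - S.Gu *ᵥ v)
    rw [← hS.step_sub, ← h2] at h3
    rw [slack_apply]
    simp only
    linarith
  have h4 : ∑ i : Fin S.N, (wsq S.P (S.pred x μ i - S.Gx *ᵥ v)
        - wsq S.P (S.pred x μ (i + 1) - S.Gx *ᵥ v)) =
      wsq S.P (x - S.Gx *ᵥ v) - wsq S.P (S.pred x μ S.N - S.Gx *ᵥ v) := by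
    rw [Fin.sum_univ_eq_sum_range (fun i => wsq S.P (S.pred x μ i - S.Gx *ᵥ v)
        - wsq S.P (S.pred x μ (i + 1) - S.Gx *ᵥ v))]
    exact Finset.sum_range_sub' (fun i => wsq S.P (S.pred x μ i - S.Gx *ᵥ v)) S.N
  rw [← Finset.sum_congr rfl (fun i _ => h1 i), Finset.sum_sub_distrib] at h4
  rw [OCPCost, slackCost]
  linarith

theorem sum_input_le_cost (hS : S.Regular)
    (x : Fin nx → ℝ) (v : Fin nz → ℝ) (μ : Fin S.N → Fin nu → ℝ) :
    ∑ i, wsq S.R (μ i - S.Gu *ᵥ v) ≤ S.OCPCost x v μ := by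
  rw [OCPCost, Finset.sum_add_distrib]
  have h1 := wsq_nonneg hS.riccati.1 (S.pred x μ S.N - S.Gx *ᵥ v)
  have h2 : 0 ≤ ∑ i : Fin S.N, wsq S.Q (S.pred x μ i - S.Gx *ᵥ v) :=
    Finset.sum_nonneg fun i _ => wsq_nonneg hS.Q_nonneg _
  linarith

theorem sum_input_pos (hS : S.Regular)
    {m : Fin S.N → Fin nu → ℝ} (hm : m ≠ 0) : 0 < ∑ i, wsq S.R (m i) := by
  obtain ⟨i, hi⟩ := Function.ne_iff.1 hm
  exact Finset.sum_pos' (fun i _ => wsq_nonneg hS.R_pos.posSemidef _)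
    ⟨i, Finset.mem_univ _, wsq_pos hS.R_pos hi⟩

/-- For zero state and reference the slack cost is the whole cost, which dominates the positive
definite input terms. -/
theorem slackCost_pos (hS : S.Regular) {m : Fin S.N → Fin nu → ℝ} (hm : m ≠ 0) :
    0 < S.slackCost ((0, 0), m) := by
  have h1 := hS.cost_eq 0 0 m
  have h2 := hS.sum_input_le_cost 0 0 m
  have h3 := hS.sum_input_pos hm
  simp only [mulVec_zero, sub_zero, wsq_zero, zero_add] at h1 h2
  linarith

theorem slackCost_nonneg (hS : S.Regular) (p : S.Plan) : 0 ≤ S.slackCost p :=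
  Finset.sum_nonneg fun _ _ => wsq_nonneg hS.slackWeight_posDef.posSemidef _

theorem slackCost_add_le (hS : S.Regular) {θ : ℝ} (hθ : 0 < θ) (p p' : S.Plan) :
    S.slackCost (p + p') ≤ (1 + θ) * S.slackCost p + (1 + 1 / θ) * S.slackCost p' := by
  rw [slackCost, slackCost, slackCost, Finset.mul_sum, Finset.mul_sum, ← Finset.sum_add_distrib]
  refine Finset.sum_le_sum fun i _ => ?_
  rw [map_add]
  exact wsq_add_le hS.slackWeight_posDef.posSemidef hθ _ _

/-- Coercivity comes from the input terms of the cost, strict midpoint convexity from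
`slackCost_pos` applied to the difference of two input sequences. -/
theorem existsUnique_OCP_minimizer (hS : S.Regular) {x : Fin nx → ℝ} {v : Fin nz → ℝ}
    (hp : IsPolyhedral {p : S.Plan | S.OCPFeasible p.1.1 p.1.2 p.2}) (hne : (x, v) ∈ S.Γ) :
    ∃! μ, S.IsOCPMinimizer x v μ := by
  have hcont : Continuous fun m : Fin S.N → Fin nu → ℝ => ∑ i, wsq S.R (m i) :=
    continuous_finsetSum _ fun i _ => (continuous_wsq _).comp (continuous_apply i)
  obtain ⟨c, hc0, hcl⟩ := exists_lower_of_homogeneous hcont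
    (fun c m => by simp [wsq_smul, Finset.mul_sum]) (fun m hm => hS.sum_input_pos hm)
  refine existsUnique_minimizer (s := {μ | S.OCPFeasible x v μ}) (f := S.OCPCost x v)
    (x₀ := fun _ => S.Gu *ᵥ v) ?_ ?_ hne ?_ hc0 ?_ ?_
  · exact hp.isClosed.preimage (f := fun μ : Fin S.N → Fin nu → ℝ => (((x, v), μ) : S.Plan))
      (by fun_prop)
  · intro μ hμ ν hν a b ha hb hab
    have h1 := hp.convex (x := ((x, v), μ)) hμ (y := ((x, v), ν)) hν ha hb hab
    have h2 : a • (((x, v), μ) : S.Plan) + b • ((x, v), ν) = ((x, v), a • μ + b • ν) := by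
      simp [Prod.smul_mk, Prod.mk_add_mk, ← add_smul, hab]
    rw [h2] at h1
    exact h1
  · have : S.OCPCost x v = fun μ => wsq S.P (x - S.Gx *ᵥ v) + S.slackCost ((x, v), μ) :=
      funext fun μ => hS.cost_eq x v μ
    rw [this]
    exact continuous_const.add (S.continuous_slackCost.comp (by fun_prop))
  · exact fun μ => (hcl _).trans (hS.sum_input_le_cost x v μ)
  · intro μ ν hμν
    have h1 := S.slackCost_midpoint ((x, v), μ) ((x, v), ν)
    have h2 : (1 / 2 : ℝ) • ((((x, v), μ) : S.Plan) + ((x, v), ν))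
        = ((x, v), (1 / 2 : ℝ) • (μ + ν)) := by
      simp only [Prod.smul_mk, Prod.mk_add_mk, ← two_smul ℝ x, ← two_smul ℝ v, smul_smul]
      norm_num
    have h3 : (((x, v), μ) : S.Plan) - ((x, v), ν) = ((0, 0), μ - ν) := by
      simp only [Prod.mk_sub_mk, sub_self]
      rfl
    rw [h2, h3] at h1
    have h4 := hS.slackCost_pos (sub_ne_zero.2 hμν)
    rw [hS.cost_eq, hS.cost_eq, hS.cost_eq, h1]
    linarith

end Regular

end Data

namespace Data

variable {nx nu ny nz nc : ℕ} {S : Data nx nu ny nz nc}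

/-! ### Geometry of the constraint and terminal sets -/

variable (S) in
/-- The input of the terminal law. -/
noncomputable def termInput (v : Fin nz → ℝ) (x : Fin nx → ℝ) : Fin nu → ℝ :=
  S.Gu *ᵥ v - S.K *ᵥ (x - S.Gx *ᵥ v)

theorem termStep_eq (v : Fin nz → ℝ) (x : Fin nx → ℝ) :
    S.termStep v x = S.A *ᵥ x + S.B *ᵥ S.termInput v x := by
  simp only [termStep, termInput, sub_mulVec, mulVec_sub, mulVec_add, ← mulVec_mulVec]
  abel

theorem termOut_eq (v : Fin nz → ℝ) (x : Fin nx → ℝ) :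
    S.termOut v x = S.C *ᵥ x + S.D *ᵥ S.termInput v x := by
  simp only [termOut, termInput, sub_mulVec, mulVec_sub, mulVec_add, ← mulVec_mulVec]
  abel

theorem termOut_eq_steady (v : Fin nz → ℝ) (x : Fin nx → ℝ) :
    S.termOut v x = S.steadyOutput *ᵥ v + S.closedOutput *ᵥ (x - S.Gx *ᵥ v) := by
  simp only [termOut, steadyOutput, closedOutput, add_mulVec, sub_mulVec, mulVec_sub, mulVec_add,
    ← mulVec_mulVec]
  abel

theorem termInput_slack (v : Fin nz → ℝ) (x : Fin nx → ℝ) :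
    (S.termInput v x - S.Gu *ᵥ v) + S.K *ᵥ (x - S.Gx *ᵥ v) = 0 := by
  rw [termInput]
  abel

theorem Y_isPolyhedral : IsPolyhedral S.Y := by
  refine ⟨range fun i => (LinearMap.toContinuousLinearMap
    (LinearMap.proj (φ := fun _ => ℝ) i ∘ₗ S.Yc.mulVecLin), S.h i), finite_range _, ?_⟩
  ext y
  simp only [mem_ofPred_eq, forall_mem_range]
  rfl

theorem pred_zero (x : Fin nx → ℝ) (μ : Fin S.N → Fin nu → ℝ) : S.pred x μ 0 = x := rfl

theorem pred_succ (x : Fin nx → ℝ) (μ : Fin S.N → Fin nu → ℝ) (i : Fin S.N) :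
    S.pred x μ (i + 1) = S.A *ᵥ S.pred x μ i + S.B *ᵥ μ i := by simp [pred]

theorem reps_of_mem_Γ {x : Fin nx → ℝ} {v : Fin nz → ℝ} (h : (x, v) ∈ S.Γ) : v ∈ S.Reps := by
  obtain ⟨μ, hμ⟩ := h
  exact hμ.2.1

theorem fst_image_Λ : Prod.fst '' S.Λ = {x | ∃ v, (x, v) ∈ S.Γ} := by
  ext x
  constructor
  · rintro ⟨⟨x, v⟩, h, rfl⟩
    exact ⟨v, h.1⟩
  · rintro ⟨v, h⟩
    exact ⟨(x, v), ⟨h, mem_univ _, reps_of_mem_Γ h⟩, rfl⟩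

theorem termStep_mem_T {x : Fin nx → ℝ} {v : Fin nz → ℝ} (h : (x, v) ∈ S.T) :
    (S.termStep v x, v) ∈ S.T :=
  ⟨h.1, fun i => by simpa only [Function.iterate_succ_apply] using h.2 (i + 1)⟩

theorem termOut_mem_Y {x : Fin nx → ℝ} {v : Fin nz → ℝ} (h : (x, v) ∈ S.T) :
    S.termOut v x ∈ S.Y := h.2 0

theorem iterate_mem_T {x : Fin nx → ℝ} {v : Fin nz → ℝ} (h : (x, v) ∈ S.T) (i : ℕ) :
    ((S.termStep v)^[i] x, v) ∈ S.T := by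
  induction i with
  | zero => exact h
  | succ i ih =>
    rw [Function.iterate_succ_apply']
    exact termStep_mem_T ih

namespace Regular

theorem one_sub_eps_pos (hS : S.Regular) : 0 < 1 - S.ε := sub_pos.2 hS.eps.2

theorem mem_Reps_iff (hS : S.Regular) (v : Fin nz → ℝ) :
    v ∈ S.Reps ↔ (1 - S.ε)⁻¹ • (S.steadyOutput *ᵥ v) ∈ S.Y :=
  mem_smul_set_iff_inv_smul_mem₀ hS.one_sub_eps_pos.ne' _ _

theorem reps_isPolyhedral (hS : S.Regular) : IsPolyhedral S.Reps := by
  convert Y_isPolyhedral.preimage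
    (LinearMap.toContinuousLinearMap ((1 - S.ε)⁻¹ • S.steadyOutput.mulVecLin)) using 1
  ext v
  exact hS.mem_Reps_iff v

theorem zero_mem_Y (hS : S.Regular) : (0 : Fin ny → ℝ) ∈ S.Y := interior_subset hS.interior

theorem zero_mem_Reps (hS : S.Regular) : (0 : Fin nz → ℝ) ∈ S.Reps := by
  rw [hS.mem_Reps_iff]
  simpa using hS.zero_mem_Y

/-- Steady-state outputs of strictly admissible references have a uniform margin. -/
theorem exists_margin (hS : S.Regular) : ∃ η : ℝ, 0 < η ∧ ∀ v ∈ S.Reps, ∀ z, ‖z‖ ≤ η →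
    S.steadyOutput *ᵥ v + z ∈ S.Y := by
  obtain ⟨δ, hδ, hball⟩ := Metric.mem_nhds_iff.1 (mem_interior_iff_mem_nhds.1 hS.interior)
  have hε := hS.eps.1
  refine ⟨S.ε * (δ / 2), by positivity, fun v hv z hz => ?_⟩
  have h1 := (hS.mem_Reps_iff v).1 hv
  have h2 : S.ε⁻¹ • z ∈ S.Y := by
    refine hball ?_
    rw [mem_ball_zero_iff, norm_smul, Real.norm_eq_abs, abs_of_pos (inv_pos.2 hε),
      inv_mul_lt_iff₀ hε]
    nlinarith
  -- The perturbed output is the convex combination, with weights `1 - ε` and `ε`, of the unscaled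
  -- steady output and of `ε⁻¹ • z`, both in `Y`.
  have h3 := Y_isPolyhedral.convex h1 h2 hS.one_sub_eps_pos.le hε.le (by ring)
  rwa [smul_inv_smul₀ hS.one_sub_eps_pos.ne', smul_inv_smul₀ hε.ne'] at h3

/-- Compactness of `Y` converts satisfied constraints into the norm bound required by
`exists_finite_determination`. -/
theorem exists_deviation_bound (hS : S.Regular) : ∃ M : ℝ, ∀ v ∈ S.Reps, ∀ z,
    S.steadyOutput *ᵥ v + z ∈ S.Y → ‖z‖ ≤ M := by
  obtain ⟨M, hM⟩ := hS.compact.isBounded.exists_norm_le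
  refine ⟨M + (1 - S.ε) * M, fun v hv z hz => ?_⟩
  have h1 := hM _ ((hS.mem_Reps_iff v).1 hv)
  rw [norm_smul, Real.norm_eq_abs, abs_of_pos (inv_pos.2 hS.one_sub_eps_pos),
    inv_mul_le_iff₀ hS.one_sub_eps_pos] at h1
  calc ‖z‖ = ‖(S.steadyOutput *ᵥ v + z) - S.steadyOutput *ᵥ v‖ := by rw [add_sub_cancel_left]
    _ ≤ _ := (norm_sub_le _ _).trans (add_le_add (hM _ hz) h1)

theorem termStep_sub (hS : S.Regular) (v : Fin nz → ℝ) (x : Fin nx → ℝ) :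
    S.termStep v x - S.Gx *ᵥ v = S.closedMatrix *ᵥ (x - S.Gx *ᵥ v) := by
  rw [termStep_eq, hS.step_sub_closed, termInput]
  simp

theorem iterate_sub (hS : S.Regular) (v : Fin nz → ℝ) (x : Fin nx → ℝ) (i : ℕ) :
    (S.termStep v)^[i] x - S.Gx *ᵥ v = (S.closedMatrix ^ i) *ᵥ (x - S.Gx *ᵥ v) := by
  induction i with
  | zero => simp
  | succ i ih => rw [Function.iterate_succ_apply', hS.termStep_sub, ih, mulVec_mulVec, pow_succ']

theorem mem_T_iff (hS : S.Regular)
    (x : Fin nx → ℝ) (v : Fin nz → ℝ) : (x, v) ∈ S.T ↔ v ∈ S.Reps ∧ ∀ i : ℕ,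
    S.steadyOutput *ᵥ v + (S.closedOutput * S.closedMatrix ^ i) *ᵥ (x - S.Gx *ᵥ v) ∈ S.Y := by
  simp only [T, mem_ofPred_eq, termOut_eq_steady, hS.iterate_sub, mulVec_mulVec]

theorem exists_output_decay (hS : S.Regular) : ∃ b : ℕ → ℝ, Tendsto b atTop (𝓝 0) ∧
    ∀ i x, ‖(S.closedOutput * S.closedMatrix ^ i) *ᵥ x‖ ≤ b i * ‖x‖ := by
  obtain ⟨c, C, hc0, hc1, hC, h⟩ := hS.isSchur.exists_pow_decay
  set g := LinearMap.toContinuousLinearMap S.closedOutput.mulVecLin with hg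
  refine ⟨fun i => ‖g‖ * (C * c ^ i), ?_, fun i x => ?_⟩
  · simpa using ((tendsto_pow_atTop_nhds_zero_of_lt_one hc0.le hc1).const_mul C).const_mul ‖g‖
  · rw [← mulVec_mulVec, mul_assoc]
    exact (g.le_opNorm _).trans (by gcongr; exact h i x)

/-- Output deviations under the terminal law are bounded by a fixed multiple of the initial error,
so the margin absorbs them. The radius does not depend on `v`, which matters while the governor is
still moving. -/
theorem exists_mem_T_of_close (hS : S.Regular)
    : ∃ η : ℝ, 0 < η ∧ ∀ v ∈ S.Reps, ∀ x, ‖x - S.Gx *ᵥ v‖ ≤ η →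
    (x, v) ∈ S.T := by
  obtain ⟨δ, hδ, h⟩ := hS.exists_margin
  obtain ⟨b, hb, hbound⟩ := hS.exists_output_decay
  obtain ⟨C, hC⟩ := hb.bddAbove_range
  have hC' : ∀ i, b i ≤ max C 1 := fun i => (hC ⟨i, rfl⟩).trans (le_max_left _ _)
  have hpos : 0 < max C 1 := by positivity
  refine ⟨δ / max C 1, by positivity, fun v hv x hx => (hS.mem_T_iff x v).2 ⟨hv, fun i => ?_⟩⟩
  refine h v hv _ ((hbound i _).trans ?_)
  calc _ ≤ max C 1 * (δ / max C 1) := by gcongr; exact hC' i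
    _ = δ := by field_simp

/-- The terminal set is determined by finitely many of its constraints. -/
theorem T_isPolyhedral (hS : S.Regular) : IsPolyhedral S.T := by
  obtain ⟨δ, hδ, h⟩ := hS.exists_margin
  obtain ⟨b, hb, hbound⟩ := hS.exists_output_decay
  obtain ⟨M, hM⟩ := hS.exists_deviation_bound
  obtain ⟨J, hJ⟩ := exists_finite_determination
    (fun i => (S.closedOutput * S.closedMatrix ^ i).mulVecLin) hb hbound M hδ
  have key : S.T = (Prod.snd ⁻¹' S.Reps) ∩ {p | ∀ i ∈ Finset.range J, p ∈
      {p : (Fin nx → ℝ) × (Fin nz → ℝ) | S.steadyOutput *ᵥ p.2 +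
        (S.closedOutput * S.closedMatrix ^ i) *ᵥ (p.1 - S.Gx *ᵥ p.2) ∈ S.Y}} := by
    ext ⟨x, v⟩
    rw [hS.mem_T_iff]
    refine and_congr_right fun hv => ⟨fun H i _ => H i, fun H i => ?_⟩
    rcases lt_or_ge i J with hi | hi
    · exact H i (Finset.mem_range.2 hi)
    -- Late outputs deviate by at most the margin once the first `J` deviations are bounded, so
    -- their constraints are redundant.
    · refine h v hv _ (hJ _ (fun j hj => ?_) i hi)
      exact hM v hv _ (H j (Finset.mem_range.2 hj))
  rw [key]
  refine (hS.reps_isPolyhedral.preimage (ContinuousLinearMap.snd ℝ (Fin nx → ℝ) _)).inter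
    (isPolyhedral_iInter_finset _ fun i => ?_)
  exact Y_isPolyhedral.preimage (LinearMap.toContinuousLinearMap
    (S.steadyOutput.mulVecLin ∘ₗ LinearMap.snd ℝ (Fin nx → ℝ) (Fin nz → ℝ) +
      (S.closedOutput * S.closedMatrix ^ i).mulVecLin ∘ₗ (LinearMap.fst ℝ _ _ -
        S.Gx.mulVecLin ∘ₗ LinearMap.snd ℝ _ _)))

theorem feasible_isPolyhedral (hS : S.Regular) :
    IsPolyhedral {p : S.Plan | S.OCPFeasible p.1.1 p.1.2 p.2} := by
  have key : {p : S.Plan | S.OCPFeasible p.1.1 p.1.2 p.2} =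
      {p | ∀ i ∈ (Finset.univ : Finset (Fin S.N)), p ∈
        {p : S.Plan | S.C *ᵥ S.predMap i p + S.D *ᵥ p.2 i ∈ S.Y}} ∩
      {p : S.Plan | (S.predMap S.N p, p.1.2) ∈ S.T} := by
    ext p
    simp [OCPFeasible, predMap_apply]
  rw [key]
  refine (isPolyhedral_iInter_finset _ fun i => ?_).inter ?_
  · exact Y_isPolyhedral.preimage (LinearMap.toContinuousLinearMap
      (S.C.mulVecLin ∘ₗ S.predMap i + S.D.mulVecLin ∘ₗ
        LinearMap.proj (φ := fun _ => Fin nu → ℝ) i ∘ₗ LinearMap.snd ℝ _ _))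
  · exact hS.T_isPolyhedral.preimage (LinearMap.toContinuousLinearMap
      ((S.predMap S.N).prod (LinearMap.snd ℝ _ _ ∘ₗ LinearMap.fst ℝ _ _)))

theorem Γ_isPolyhedral (hS : S.Regular) : IsPolyhedral S.Γ := by
  convert hS.feasible_isPolyhedral.fiber_lipschitz.1 using 1
  rfl

/-- Feasible input sequences can be chosen to depend on the state and the reference in a
Lipschitz way. -/
theorem exists_lipschitz_feasible (hS : S.Regular) : ∃ L : ℝ, 0 ≤ L ∧ ∀ x v μ, S.OCPFeasible x v μ →
    ∀ x' v', (x', v') ∈ S.Γ → ∃ μ', S.OCPFeasible x' v' μ' ∧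
      ‖μ' - μ‖ ≤ L * ‖(x', v') - (x, v)‖ := by
  obtain ⟨L, hL, h⟩ := hS.feasible_isPolyhedral.fiber_lipschitz.2
  exact ⟨L, hL, fun x v μ hμ x' v' h' => h (x, v) μ hμ (x', v') h'⟩

theorem reference_slice_closed (hS : S.Regular) (x : Fin nx → ℝ) : IsClosed {v | (x, v) ∈ S.Γ} :=
  hS.Γ_isPolyhedral.isClosed.preimage (f := fun v => (x, v)) (by fun_prop)

theorem reference_slice_convex (hS : S.Regular) (x : Fin nx → ℝ) : Convex ℝ {v | (x, v) ∈ S.Γ} := by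
  intro v hv w hw a b ha hb hab
  have h1 := hS.Γ_isPolyhedral.convex (x := (x, v)) hv (y := (x, w)) hw ha hb hab
  rw [Prod.smul_mk, Prod.smul_mk, Prod.mk_add_mk, ← add_smul, hab, one_smul] at h1
  exact h1

theorem existsUnique_minimizer (hS : S.Regular)
    {x : Fin nx → ℝ} {v : Fin nz → ℝ} (h : (x, v) ∈ S.Γ) :
    ∃! μ, S.IsOCPMinimizer x v μ :=
  hS.existsUnique_OCP_minimizer hS.feasible_isPolyhedral h

theorem existsUnique_governorOutput (hS : S.Regular) (r : Fin nz → ℝ) {x : Fin nx → ℝ}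
    (hx : ∃ v, (x, v) ∈ S.Γ) : ∃! v, S.IsGovernorOutput r x v := by
  have key : ∀ v, S.IsGovernorOutput r x v ↔ v ∈ {v | (x, v) ∈ S.Γ} ∧
      ∀ w ∈ {v | (x, v) ∈ S.Γ}, nsq (v - r) ≤ nsq (w - r) := by
    intro v
    constructor
    · exact fun h => ⟨h.1.2, fun w hw => h.2 w (reps_of_mem_Γ hw) hw⟩
    · exact fun h => ⟨⟨reps_of_mem_Γ h.1, h.1⟩, fun w _ hw => h.2 w hw⟩
  simp only [key]
  exact existsUnique_nearest (hS.reference_slice_closed x) (hS.reference_slice_convex x) hx r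

theorem existsUnique_projection (hS : S.Regular) (r : Fin nz → ℝ) : ∃! v, S.IsProjection r v :=
  existsUnique_nearest hS.reps_isPolyhedral.isClosed hS.reps_isPolyhedral.convex
    ⟨0, hS.zero_mem_Reps⟩ r

/-! ### One step of the closed loop -/

/-- The terminal law has no slack and keeps `T` invariant, so it is an optimal plan from `T`;
elsewhere it serves as the comparison plan. -/
theorem exists_feasible_of_mem_T {x : Fin nx → ℝ} {v : Fin nz → ℝ} (h : (x, v) ∈ S.T) :
    ∃ μ, S.OCPFeasible x v μ ∧ S.slackCost ((x, v), μ) = 0 := by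
  set μ : Fin S.N → Fin nu → ℝ := fun i => S.termInput v ((S.termStep v)^[i] x) with hμ
  have hpred : ∀ i ≤ S.N, S.pred x μ i = (S.termStep v)^[i] x := by
    intro i
    induction i with
    | zero => intro _; rfl
    | succ i ih =>
      intro hi
      rw [pred_succ x μ ⟨i, hi⟩, Function.iterate_succ_apply', termStep_eq]
      simp only [ih (Nat.le_of_succ_le hi)]
      rfl
  refine ⟨μ, ⟨fun i => ?_, ?_⟩, ?_⟩
  · rw [hpred i i.2.le, ← termOut_eq]
    exact h.2 i
  · rw [hpred S.N le_rfl]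
    exact iterate_mem_T h _
  · refine Finset.sum_eq_zero fun i _ => ?_
    rw [slack_apply]
    simp only [hpred i i.2.le]
    rw [hμ, termInput_slack, wsq_zero]

theorem mem_Γ_of_mem_T {x : Fin nx → ℝ} {v : Fin nz → ℝ} (h : (x, v) ∈ S.T) : (x, v) ∈ S.Γ := by
  obtain ⟨μ, hμ, -⟩ := exists_feasible_of_mem_T h
  exact ⟨μ, hμ⟩

/-- Recursive feasibility: the first input is dropped and the terminal law appended. The appended
input has zero slack, so the slack cost loses exactly its first term. -/
theorem exists_shift {x : Fin nx → ℝ} {v : Fin nz → ℝ} {μ : Fin S.N → Fin nu → ℝ}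
    (h : S.OCPFeasible x v μ) :
    ∃ μ', S.OCPFeasible (S.A *ᵥ x + S.B *ᵥ μ ⟨0, S.N_pos⟩) v μ' ∧
      S.slackCost ((S.A *ᵥ x + S.B *ᵥ μ ⟨0, S.N_pos⟩, v), μ') + wsq S.slackWeight
        (S.slack ⟨0, S.N_pos⟩ ((x, v), μ)) = S.slackCost ((x, v), μ) := by
  set x' := S.A *ᵥ x + S.B *ᵥ μ ⟨0, S.N_pos⟩ with hx'
  set μ' : Fin S.N → Fin nu → ℝ := fun i => if hi : i + 1 < S.N then μ ⟨i + 1, hi⟩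
    else S.termInput v (S.pred x μ S.N) with hμ'
  have hpred : ∀ i < S.N, S.pred x' μ' i = S.pred x μ (i + 1) := by
    intro i
    induction i with
    | zero => intro _; rw [pred_zero, pred_succ x μ ⟨0, S.N_pos⟩]; rfl
    | succ i ih =>
      intro hi
      rw [pred_succ x' μ' ⟨i, by omega⟩, pred_succ x μ ⟨i + 1, hi⟩]
      simp only [ih (by omega)]
      simp [hμ', hi]
  have hlast : ∀ i : Fin S.N, ¬ (i + 1 < S.N) → (i : ℕ) + 1 = S.N := fun i hi => by omega
  have hpredN : S.pred x' μ' S.N = S.termStep v (S.pred x μ S.N) := by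
    have hN := S.N_pos
    obtain ⟨m, hm⟩ : ∃ m : ℕ, m + 1 = S.N := ⟨S.N - 1, by omega⟩
    have h1 := pred_succ x' μ' ⟨m, by omega⟩
    simp only [hpred m (by omega), hm] at h1
    rw [h1, termStep_eq]
    simp [hμ', hm]
  refine ⟨μ', ⟨fun i => ?_, ?_⟩, ?_⟩
  · rw [hpred i i.2]
    by_cases hi : i + 1 < S.N
    · simpa [hμ', hi] using h.1 ⟨i + 1, hi⟩
    · have h1 := termOut_mem_Y h.2
      rw [termOut_eq] at h1
      simpa [hμ', hlast i hi] using h1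
  · rw [hpredN]
    exact termStep_mem_T h.2
  -- The default value `0` at index `N` is the slack of the appended terminal input, so the new cost
  -- is the shifted sum.
  · set f : ℕ → ℝ := fun i => if hi : i < S.N then
      wsq S.slackWeight (S.slack ⟨i, hi⟩ ((x, v), μ)) else 0 with hf
    have h1 : S.slackCost ((x, v), μ) = ∑ i ∈ Finset.range S.N, f i := by
      rw [← Fin.sum_univ_eq_sum_range]
      exact Finset.sum_congr rfl fun i _ => by simp [hf]
    have h2 : S.slackCost ((x', v), μ') = ∑ i ∈ Finset.range S.N, f (i + 1) := by
      rw [← Fin.sum_univ_eq_sum_range (fun i => f (i + 1))]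
      refine Finset.sum_congr rfl fun i _ => ?_
      rw [slack_apply]
      simp only [hpred i i.2]
      by_cases hi : i + 1 < S.N
      · simp [hf, hi, hμ', slack_apply]
      · simp [hf, hμ', hlast i hi, termInput_slack, wsq_zero]
    have h3 := Finset.sum_range_succ f S.N
    have h4 := Finset.sum_range_succ' f S.N
    have h5 : f S.N = 0 := by simp [hf]
    have h6 : f 0 = wsq S.slackWeight (S.slack ⟨0, S.N_pos⟩ ((x, v), μ)) := by
      simp [hf, S.N_pos]
    linarith

end Regular

end Data

/-! ### Scalar inequalities and convergence from decrease -/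

theorem sq_add_le_young {θ : ℝ} (hθ : 0 < θ) (a b : ℝ) :
    (a + b) ^ 2 ≤ (1 + θ) * a ^ 2 + (1 + 1 / θ) * b ^ 2 := by
  have h : 0 ≤ (1 / θ) * (θ * a - b) ^ 2 := by positivity
  have h2 : (1 / θ) * (θ * a - b) ^ 2 = θ * a ^ 2 - 2 * a * b + 1 / θ * b ^ 2 := by
    field_simp
    ring
  nlinarith

/-- Young's inequality with parameter `(1 - c) / c`, which gives up one factor of `c ^ 2`. -/
theorem sq_contract_add_le {c : ℝ} (hc0 : 0 < c) (hc1 : c < 1) (a b : ℝ) :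
    (c * a + b) ^ 2 ≤ c * a ^ 2 + b ^ 2 / (1 - c) := by
  have h1 : 0 < 1 - c := by linarith
  have h : 0 ≤ c / (1 - c) * ((1 - c) * a - b) ^ 2 := by positivity
  have h2 : c * a ^ 2 + b ^ 2 / (1 - c) - (c * a + b) ^ 2
      = c / (1 - c) * ((1 - c) * a - b) ^ 2 := by
    field_simp
    ring
  linarith

theorem tendsto_zero_of_decrease {Ψ U : ℕ → ℝ} {c : ℝ} (hc : 0 < c) (hΨ : ∀ k, 0 ≤ Ψ k)
    (hU : ∀ k, 0 ≤ U k) (h : ∀ k, Ψ (k + 1) ≤ Ψ k - c * U k) : Tendsto U atTop (𝓝 0) := by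
  have hanti : Antitone Ψ := antitone_nat_of_succ_le fun k => by
    have := mul_nonneg hc.le (hU k)
    linarith [h k]
  have hlim := tendsto_atTop_ciInf hanti ⟨0, by rintro _ ⟨k, rfl⟩; exact hΨ k⟩
  have hdiff : Tendsto (fun k => c⁻¹ * (Ψ k - Ψ (k + 1))) atTop (𝓝 0) := by
    simpa using (hlim.sub ((tendsto_add_atTop_iff_nat 1).2 hlim)).const_mul c⁻¹
  refine squeeze_zero hU (fun k => ?_) hdiff
  rw [inv_mul_eq_div, le_div_iff₀ hc]
  linarith [h k]

theorem exists_mulVec_norm_le {m n : ℕ} (M : Matrix (Fin m) (Fin n) ℝ) :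
    ∃ C : ℝ, 0 ≤ C ∧ ∀ x, ‖M *ᵥ x‖ ≤ C * ‖x‖ :=
  ⟨_, norm_nonneg _, fun x => (LinearMap.toContinuousLinearMap M.mulVecLin).le_opNorm x⟩

theorem nsq_nonneg {n : ℕ} (x : Fin n → ℝ) : 0 ≤ nsq x := by
  rw [nsq_eq_wsq]
  exact wsq_nonneg Matrix.PosSemidef.one x

theorem nsq_convex {n : ℕ} {t : ℝ} (h0 : 0 ≤ t) (h1 : t ≤ 1) (a b : Fin n → ℝ) :
    nsq ((1 - t) • a + t • b) ≤ (1 - t) * nsq a + t * nsq b := by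
  have h := nsq_nonneg (a - b)
  have h2 : (1 - t) * nsq a + t * nsq b - nsq ((1 - t) • a + t • b)
      = t * (1 - t) * nsq (a - b) := by
    simp only [nsq, add_dotProduct, dotProduct_add, sub_dotProduct, dotProduct_sub,
      smul_dotProduct, dotProduct_smul, smul_eq_mul, dotProduct_comm b a]
    ring
  have h3 : 0 ≤ t * (1 - t) * nsq (a - b) := by
    have : 0 ≤ 1 - t := by linarith
    positivity
  linarith

/-! ### The governor and the input-to-state Lyapunov function -/

namespace Data

variable {nx nu ny nz nc : ℕ} {S : Data nx nu ny nz nc}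

namespace Regular

/-- The midpoint of `v` and `w` is feasible by convexity, hence no closer to `r` than `v`; the
parallelogram identity does the rest. In the closed loop `w` is the previous reference. -/
theorem governor_move (hS : S.Regular) {r : Fin nz → ℝ} {x : Fin nx → ℝ} {v w : Fin nz → ℝ}
    (hv : S.IsGovernorOutput r x v) (hw : (x, w) ∈ S.Γ) :
    nsq (v - w) / 2 ≤ nsq (w - r) - nsq (v - r) := by
  have h1 : (x, (1 / 2 : ℝ) • v + (1 / 2 : ℝ) • w) ∈ S.Γ :=
    hS.reference_slice_convex x hv.1.2 hw (by norm_num) (by norm_num) (by norm_num)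
  have h2 := hv.2 _ (reps_of_mem_Γ h1) h1
  have h3 : (1 / 2 : ℝ) • v + (1 / 2 : ℝ) • w - r = (1 / 2 : ℝ) • ((v - r) + (w - r)) := by
    ext i; simp; ring
  rw [h3, nsq_eq_wsq, nsq_eq_wsq, wsq_midpoint, sub_sub_sub_cancel_right] at h2
  simp only [nsq_eq_wsq]
  linarith

theorem governor_eq_of_feasible {r : Fin nz → ℝ} {x : Fin nx → ℝ} {v rs : Fin nz → ℝ}
    (hrs : ∀ v, S.IsProjection r v ↔ v = rs) (hv : S.IsGovernorOutput r x v)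
    (h : (x, rs) ∈ S.Γ) : v = rs := by
  refine (hrs v).1 ⟨hv.1.1, fun w hw => ?_⟩
  have h1 := (hrs rs).2 rfl
  exact (hv.2 rs h1.1 h).trans (h1.2 w hw)

/-- Near a steady state the governor is inactive: its output is the projected reference. -/
theorem exists_governor_eq_of_close (hS : S.Regular) {r : Fin nz → ℝ} {rs : Fin nz → ℝ}
    (hrs : ∀ v, S.IsProjection r v ↔ v = rs) : ∃ η : ℝ, 0 < η ∧ ∀ x v,
      S.IsGovernorOutput r x v → ‖x - S.Gx *ᵥ v‖ < η → v = rs := by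
  obtain ⟨η, hη, hT⟩ := hS.exists_mem_T_of_close
  refine ⟨η, hη, fun x v hv hx => ?_⟩
  have hproj := (hrs rs).2 rfl
  have hcont : Continuous fun t : ℝ => ‖x - S.Gx *ᵥ ((1 - t) • v + t • rs)‖ := by
    have : Continuous (S.Gx *ᵥ ·) := S.Gx.mulVecLin.continuous_of_finiteDimensional
    exact (continuous_const.sub (this.comp (by fun_prop))).norm
  -- The strict inequality leaves room for a small move towards `rs` that keeps `x` in the terminal
  -- set of the moved reference.
  have h1 : ∀ᶠ t in 𝓝 (0 : ℝ), ‖x - S.Gx *ᵥ ((1 - t) • v + t • rs)‖ < η := by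
    refine hcont.continuousAt.eventually (gt_mem_nhds ?_)
    simpa using hx
  have h2 : ∀ᶠ t in 𝓝[>] (0 : ℝ), t < 1 :=
    (gt_mem_nhds (zero_lt_one' ℝ)).filter_mono nhdsWithin_le_nhds
  obtain ⟨t, ⟨ht1, ht2⟩, ht0⟩ :=
    (((h1.filter_mono nhdsWithin_le_nhds).and h2).and self_mem_nhdsWithin).exists
  change 0 < t at ht0
  have h3 : (1 - t) • v + t • rs ∈ S.Reps :=
    hS.reps_isPolyhedral.convex hv.1.1 hproj.1 (by linarith) ht0.le (by ring)
  have h4 := hv.2 _ h3 (mem_Γ_of_mem_T (hT _ h3 x ht1.le))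
  have h5 : (1 - t) • v + t • rs - r = (1 - t) • (v - r) + t • (rs - r) := by
    ext i; simp; ring
  rw [h5] at h4
  -- Optimality of `v` against the moved point, convexity and division by `t > 0` make `v` as close
  -- to `r` as `rs` is.
  have h6 := nsq_convex ht0.le ht2.le (v - r) (rs - r)
  have h7 : nsq (v - r) ≤ nsq (rs - r) := by nlinarith
  exact (hrs v).1 ⟨hv.1.1, fun w hw => h7.trans (hproj.2 w hw)⟩

theorem slackCost_le_of_minimizer (hS : S.Regular) {x : Fin nx → ℝ} {v : Fin nz → ℝ}
    {μ ν : Fin S.N → Fin nu → ℝ} (hμ : S.IsOCPMinimizer x v μ) (hν : S.OCPFeasible x v ν) :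
    S.slackCost ((x, v), μ) ≤ S.slackCost ((x, v), ν) := by
  have h := hμ.2 ν hν
  rw [hS.cost_eq, hS.cost_eq] at h
  linarith

/-- A feasible plan for `(x', v')` is chosen Lipschitz-close to `μ`, and the quadratic slack cost is
expanded by Young's inequality. The free `θ` keeps the multiplicative loss small enough for the
contraction in `exists_lyapunov`. -/
theorem exists_slackCost_perturbation (hS : S.Regular)
    : ∃ L : ℝ, 0 ≤ L ∧ ∀ x v μ, S.OCPFeasible x v μ →
    ∀ x' v' μ', S.IsOCPMinimizer x' v' μ' → ∀ θ : ℝ, 0 < θ → S.slackCost ((x', v'), μ') ≤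
      (1 + θ) * S.slackCost ((x, v), μ) + (1 + 1 / θ) * (L * ‖(x', v') - (x, v)‖ ^ 2) := by
  obtain ⟨L, hL, h⟩ := hS.exists_lipschitz_feasible
  obtain ⟨C, hC, hCb⟩ := exists_upper_of_homogeneous S.continuous_slackCost S.slackCost_smul
  refine ⟨C * (1 + L) ^ 2, by positivity, fun x v μ hμ x' v' μ' hμ' θ hθ => ?_⟩
  obtain ⟨ν, hν, hνL⟩ := h x v μ hμ x' v' ⟨μ', hμ'.1⟩
  refine (hS.slackCost_le_of_minimizer hμ' hν).trans ?_
  set d : S.Plan := ((x', v') - (x, v), ν - μ) with hd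
  have h1 : (((x', v'), ν) : S.Plan) = ((x, v), μ) + d := by
    simp [hd]
  have h2 : ‖d‖ ≤ (1 + L) * ‖(x', v') - (x, v)‖ := by
    rw [hd, Prod.norm_def]
    have h0 := norm_nonneg ((x', v') - (x, v))
    exact max_le (by nlinarith) (by simp only; nlinarith)
  rw [h1]
  refine (hS.slackCost_add_le hθ _ _).trans ?_
  gcongr
  calc S.slackCost d ≤ C * ‖d‖ ^ 2 := hCb d
    _ ≤ C * ((1 + L) * ‖(x', v') - (x, v)‖) ^ 2 := by gcongr
    _ = _ := by ring

/-- The cost of deviating from the LQR law is dominated by the distance to the steady state. -/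
theorem exists_slackCost_le (hS : S.Regular) : ∃ L : ℝ, 0 ≤ L ∧ ∀ x v μ, S.IsOCPMinimizer x v μ →
    S.slackCost ((x, v), μ) ≤ L * ‖x - S.Gx *ᵥ v‖ ^ 2 := by
  obtain ⟨L, hL, h⟩ := hS.exists_slackCost_perturbation
  obtain ⟨η, hη, hT⟩ := hS.exists_mem_T_of_close
  refine ⟨2 * L, by positivity, fun x v μ hμ => ?_⟩
  obtain ⟨ν, hν, hν0⟩ := exists_feasible_of_mem_T
    (hT v hμ.1.2.1 (S.Gx *ᵥ v) (by simpa using hη.le))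
  -- The comparison point is the steady state of `v`, where the terminal law has zero slack cost;
  -- any fixed `θ` will do.
  have h1 := h _ v ν hν x v μ hμ 1 one_pos
  have h2 : ‖(x, v) - (S.Gx *ᵥ v, v)‖ = ‖x - S.Gx *ᵥ v‖ := by simp [Prod.norm_def]
  rw [hν0, h2] at h1
  linarith

/-- An input-to-state Lyapunov function with respect to changes of the reference. -/
theorem exists_lyapunov (hS : S.Regular) : ∃ (U : S.Plan → ℝ) (ρ D : ℝ), ρ < 1 ∧ 0 ≤ D ∧
    (∀ x v μ, ‖x - S.Gx *ᵥ v‖ ^ 2 ≤ U ((x, v), μ)) ∧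
    ∀ x v μ v' μ', S.IsOCPMinimizer x v μ →
      S.IsOCPMinimizer (S.A *ᵥ x + S.B *ᵥ μ ⟨0, S.N_pos⟩) v' μ' →
      U ((S.A *ᵥ x + S.B *ᵥ μ ⟨0, S.N_pos⟩, v'), μ') ≤
        ρ * U ((x, v), μ) + D * nsq (v' - v) := by
  obtain ⟨c, a, C, hc0, hc1, hC, ha1, ha2, ha3, ha4⟩ := hS.isSchur.exists_adapted_norm
  obtain ⟨L₁, hL₁, hslack⟩ := hS.exists_slackCost_le
  obtain ⟨L₂, hL₂, hpert⟩ := hS.exists_slackCost_perturbation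
  obtain ⟨b, hb0, hb⟩ := exists_mulVec_norm_le S.B
  obtain ⟨g, hg0, hg⟩ := exists_mulVec_norm_le S.Gx
  obtain ⟨m, hm0, hm⟩ := exists_lower_of_homogeneous (continuous_wsq S.slackWeight)
    (wsq_smul _) (fun x hx => wsq_pos hS.slackWeight_posDef hx)
  obtain ⟨n, hn0, hn⟩ := exists_lower_of_homogeneous
    (continuous_wsq (1 : Matrix (Fin nz) (Fin nz) ℝ))
    (wsq_smul _) (fun x hx => wsq_pos Matrix.PosDef.one hx)
  have hc' : 0 < 1 - c := by linarith
  have ha0 : ∀ x, 0 ≤ a x := fun x => (norm_nonneg x).trans (ha1 x)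
  -- With this weight, the first slack dropped by the shift cancels its contribution `(C b ‖s‖)² /
  -- (1 - c)` to the next error.
  set γ := (C * b) ^ 2 / (1 - c) / m with hγ
  have hγ0 : 0 ≤ γ := by positivity
  have hγm : γ * m = (C * b) ^ 2 / (1 - c) := div_mul_cancel₀ _ hm0.ne'
  -- The relation `κ (1 + γ L₁) = 1 - c` and the bound of the slack cost by `L₁ a²` give `c a² + γ w
  -- ≤ (1 - κ)(a² + γ w)`. Young's inequality with `θ = κ` then costs a factor `1 + κ`, and `(1 +
  -- κ)(1 - κ) < 1`.
  set κ := (1 - c) / (1 + γ * L₁) with hκ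
  have hden : 0 < 1 + γ * L₁ := by positivity
  have hκ0 : 0 < κ := by positivity
  refine ⟨fun p => a (p.1.1 - S.Gx *ᵥ p.1.2) ^ 2 + γ * S.slackCost p, (1 + κ) * (1 - κ),
    (1 + 1 / κ) * ((C * g) ^ 2 + γ * L₂) / n, by nlinarith, by positivity, ?_, ?_⟩
  · intro x v μ
    have h1 := mul_nonneg hγ0 (hS.slackCost_nonneg ((x, v), μ))
    have h2 : ‖x - S.Gx *ᵥ v‖ ^ 2 ≤ a (x - S.Gx *ᵥ v) ^ 2 := by gcongr; exact ha1 _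
    simp only
    linarith
  · intro x v μ v' μ' hμ hμ'
    obtain ⟨ν, hν, hνeq⟩ := exists_shift hμ.1
    set x' := S.A *ᵥ x + S.B *ᵥ μ ⟨0, S.N_pos⟩ with hx'
    set s := S.slack ⟨0, S.N_pos⟩ ((x, v), μ) with hs
    set e := x - S.Gx *ᵥ v with he
    set w := S.slackCost ((x, v), μ) with hw
    set δ := ‖v' - v‖ with hδ
    have hδ0 : 0 ≤ δ := norm_nonneg _
    have hδn : δ ^ 2 ≤ nsq (v' - v) / n := by
      rw [nsq_eq_wsq, le_div_iff₀ hn0, mul_comm]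
      exact hn _
    have h1 : S.slackCost ((x', v'), μ') ≤
        (1 + κ) * (w - wsq S.slackWeight s) + (1 + 1 / κ) * (L₂ * δ ^ 2) := by
      have h2 := hpert x' v ν hν x' v' μ' hμ' κ hκ0
      have h3 : ‖(x', v') - (x', v)‖ = δ := by simp [Prod.norm_def, hδ]
      rw [h3] at h2
      have h4 : S.slackCost ((x', v), ν) = w - wsq S.slackWeight s := by linarith
      rwa [h4] at h2
    have hx'e : x' - S.Gx *ᵥ v' = (S.closedMatrix *ᵥ e + S.B *ᵥ s) + S.Gx *ᵥ (v - v') := by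
      have h2 := hS.step_sub_closed v x (μ ⟨0, S.N_pos⟩)
      have h3 : s = (μ ⟨0, S.N_pos⟩ - S.Gu *ᵥ v) + S.K *ᵥ (x - S.Gx *ᵥ v) := by
        rw [hs, slack_apply]
        rfl
      rw [h3, he, ← h2, mulVec_sub, hx']
      abel
    have h5 : a (x' - S.Gx *ᵥ v') ≤ (c * a e + C * b * ‖s‖) + C * g * δ := by
      rw [hx'e]
      refine (ha3 _ _).trans (add_le_add ((ha3 _ _).trans (add_le_add (ha4 e) ?_)) ?_)
      · refine (ha2 _).trans ?_
        rw [mul_assoc]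
        gcongr
        exact hb s
      · refine (ha2 _).trans ?_
        rw [mul_assoc, hδ, norm_sub_rev]
        gcongr
        exact hg _
    have h6 : a (x' - S.Gx *ᵥ v') ^ 2 ≤ (1 + κ) * (c * a e ^ 2 + γ * wsq S.slackWeight s)
        + (1 + 1 / κ) * ((C * g) ^ 2 * δ ^ 2) := by
      have h7 := ha0 (x' - S.Gx *ᵥ v')
      calc a (x' - S.Gx *ᵥ v') ^ 2 ≤ ((c * a e + C * b * ‖s‖) + C * g * δ) ^ 2 := by gcongr
        _ ≤ (1 + κ) * (c * a e + C * b * ‖s‖) ^ 2 + (1 + 1 / κ) * (C * g * δ) ^ 2 :=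
          sq_add_le_young hκ0 _ _
        _ ≤ (1 + κ) * (c * a e ^ 2 + γ * wsq S.slackWeight s)
            + (1 + 1 / κ) * ((C * g) ^ 2 * δ ^ 2) := by
          rw [mul_pow (C * g)]
          gcongr
          refine (sq_contract_add_le hc0 hc1 _ _).trans ?_
          gcongr
          calc (C * b * ‖s‖) ^ 2 / (1 - c) = γ * (m * ‖s‖ ^ 2) := by
                rw [← mul_assoc, hγm]
                ring
            _ ≤ γ * wsq S.slackWeight s := by gcongr; exact hm s
    have h8 : c * a e ^ 2 + γ * w ≤ (1 - κ) * (a e ^ 2 + γ * w) := by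
      have h9 : w ≤ L₁ * a e ^ 2 := (hslack x v μ hμ).trans (by gcongr; exact ha1 _)
      have h10 : κ * (1 + γ * L₁) = 1 - c := by
        rw [hκ]
        field_simp
      have h11 : κ * (γ * w) ≤ κ * (γ * (L₁ * a e ^ 2)) := by gcongr
      have h12 : κ * (1 + γ * L₁) * a e ^ 2 = (1 - c) * a e ^ 2 := by rw [h10]
      linarith
    have h13 : γ * S.slackCost ((x', v'), μ') ≤
        γ * ((1 + κ) * (w - wsq S.slackWeight s) + (1 + 1 / κ) * (L₂ * δ ^ 2)) := by gcongr
    have h14 : (1 + κ) * (c * a e ^ 2 + γ * w) ≤ (1 + κ) * ((1 - κ) * (a e ^ 2 + γ * w)) := by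
      gcongr
    have h15 : (1 + 1 / κ) * ((C * g) ^ 2 + γ * L₂) * δ ^ 2 ≤
        (1 + 1 / κ) * ((C * g) ^ 2 + γ * L₂) * (nsq (v' - v) / n) := by gcongr
    have h16 : (1 + 1 / κ) * ((C * g) ^ 2 + γ * L₂) / n * nsq (v' - v) =
        (1 + 1 / κ) * ((C * g) ^ 2 + γ * L₂) * (nsq (v' - v) / n) := by ring
    simp only [h16]
    linarith

/-! ### Trajectories of the closed loop -/

theorem successor_feasible {r : Fin nz → ℝ} {p q : (Fin nx → ℝ) × (Fin nz → ℝ)}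
    (h : S.ClosedLoop r p q) : q ∈ S.Γ := by
  obtain ⟨-, μ, hμ, hq⟩ := h
  obtain ⟨ν, hν, -⟩ := exists_shift hμ.1
  refine ⟨ν, ?_⟩
  rwa [hq]

theorem exists_successor (hS : S.Regular) (r : Fin nz → ℝ) {p : (Fin nx → ℝ) × (Fin nz → ℝ)}
    (hp : ∃ v, (p.1, v) ∈ S.Γ) : ∃ q, S.ClosedLoop r p q := by
  obtain ⟨v, hv, -⟩ := hS.existsUnique_governorOutput r hp
  obtain ⟨μ, hμ, -⟩ := hS.existsUnique_minimizer hv.1.2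
  exact ⟨(_, v), hv, μ, hμ, rfl⟩

theorem exists_trajectory (hS : S.Regular) (r : Fin nz → ℝ) {p : (Fin nx → ℝ) × (Fin nz → ℝ)}
    (hp : ∃ v, (p.1, v) ∈ S.Γ) : ∃ t, IsTrajectory (S.ClosedLoop r) t ∧ t 0 = p := by
  have h : ∀ a : {a : (Fin nx → ℝ) × (Fin nz → ℝ) // ∃ v, (a.1, v) ∈ S.Γ},
      ∃ b : {a : (Fin nx → ℝ) × (Fin nz → ℝ) // ∃ v, (a.1, v) ∈ S.Γ},
        S.ClosedLoop r a.1 b.1 := by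
    rintro ⟨a, ha⟩
    obtain ⟨q, hq⟩ := hS.exists_successor r ha
    exact ⟨⟨q, q.2, successor_feasible hq⟩, hq⟩
  choose f hf using h
  refine ⟨fun k => (f^[k] ⟨p, hp⟩).1, fun k => ?_, rfl⟩
  simp only [Function.iterate_succ_apply']
  exact hf _

theorem tendsto_of_trajectory (hS : S.Regular) {r : Fin nz → ℝ} {rs : Fin nz → ℝ}
    (hrs : ∀ v, S.IsProjection r v ↔ v = rs) {p : ℕ → (Fin nx → ℝ) × (Fin nz → ℝ)}
    (hp : IsTrajectory (S.ClosedLoop r) p) : Tendsto p atTop (𝓝 (S.Gx *ᵥ rs, rs)) := by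
  obtain ⟨U, ρ, D, hρ, hD, hU1, hU2⟩ := hS.exists_lyapunov
  obtain ⟨η, hη, hclose⟩ := hS.exists_governor_eq_of_close hrs
  choose hgov μ hμ hnext using hp
  set x : ℕ → Fin nx → ℝ := fun k => (p k).1 with hx
  -- The state at time `k` stores the previous reference, so the one applied at `x k` is found in `p
  -- (k + 1)`.
  set v : ℕ → Fin nz → ℝ := fun k => (p (k + 1)).2 with hv
  have hU0 : ∀ k, 0 ≤ U ((x k, v k), μ k) := fun k => (sq_nonneg _).trans (hU1 _ _ _)
  have hlim : Tendsto (fun k => U ((x k, v k), μ k)) atTop (𝓝 0) := by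
    -- The weight `2 D` matches the factor `1 / 2` in `governor_move`: progress of the governor
    -- absorbs the term `D * nsq (v (k + 1) - v k)`.
    refine tendsto_zero_of_decrease (c := 1 - ρ) (by linarith)
      (Ψ := fun k => U ((x k, v k), μ k) + 2 * D * nsq (v k - r)) (fun k => ?_) hU0 (fun k => ?_)
    · have := nsq_nonneg (v k - r)
      have := hU0 k
      positivity
    · have h1 := hU2 (x k) (v k) (μ k) (v (k + 1)) (μ (k + 1)) (hμ k)
        (by rw [← hnext k]; exact hμ (k + 1))
      rw [← hnext k] at h1
      have h2 : (x (k + 1), v k) ∈ S.Γ := successor_feasible ⟨hgov k, μ k, hμ k, hnext k⟩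
      have h3 := mul_le_mul_of_nonneg_left (hS.governor_move (hgov (k + 1)) h2) hD
      change D * (nsq (v (k + 1) - v k) / 2) ≤ D * (nsq (v k - r) - nsq (v (k + 1) - r)) at h3
      change U ((x (k + 1), v (k + 1)), μ (k + 1)) ≤ _ at h1
      linarith
  have herr : Tendsto (fun k => ‖x k - S.Gx *ᵥ v k‖) atTop (𝓝 0) := by
    have h1 : Tendsto (fun k => ‖x k - S.Gx *ᵥ v k‖ ^ 2) atTop (𝓝 0) :=
      squeeze_zero (fun k => sq_nonneg _) (fun k => hU1 _ _ _) hlim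
    simpa [Real.sqrt_sq] using h1.sqrt
  have hev : ∀ᶠ k in atTop, v k = rs := by
    filter_upwards [herr.eventually (gt_mem_nhds hη)] with k hk
    exact hclose _ _ (hgov k) hk
  have hvlim : Tendsto v atTop (𝓝 rs) := tendsto_const_nhds.congr' (hev.mono fun k hk => hk.symm)
  have hxlim : Tendsto x atTop (𝓝 (S.Gx *ᵥ rs)) := by
    have h1 : Tendsto (fun k => (x k - S.Gx *ᵥ v k) + S.Gx *ᵥ rs) atTop (𝓝 (S.Gx *ᵥ rs)) := by
      simpa using (tendsto_zero_iff_norm_tendsto_zero.2 herr).add_const (S.Gx *ᵥ rs)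
    refine h1.congr' (hev.mono fun k hk => ?_)
    simp only [hk, sub_add_cancel]
  rw [← tendsto_add_atTop_iff_nat 1]
  exact ((tendsto_add_atTop_iff_nat 1).2 hxlim).prodMk_nhds hvlim

/-- Inside the terminal set the closed loop is the terminal law. -/
theorem successor_eq_of_mem_T (hS : S.Regular) {r : Fin nz → ℝ} {rs : Fin nz → ℝ}
    (hrs : ∀ v, S.IsProjection r v ↔ v = rs) {p q : (Fin nx → ℝ) × (Fin nz → ℝ)}
    (hT : (p.1, rs) ∈ S.T) (h : S.ClosedLoop r p q) : q = (S.termStep rs p.1, rs) := by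
  obtain ⟨hgov, μ, hμ, hq⟩ := h
  have h2 : q.2 = rs := governor_eq_of_feasible hrs hgov (mem_Γ_of_mem_T hT)
  rw [h2] at hμ
  obtain ⟨ν, hν, hν0⟩ := exists_feasible_of_mem_T hT
  have h3 := hS.slackCost_le_of_minimizer hμ hν
  have h4 := (Finset.sum_eq_zero_iff_of_nonneg fun i _ =>
    wsq_nonneg hS.slackWeight_posDef.posSemidef (S.slack i ((p.1, rs), μ))).1
    (le_antisymm (h3.trans hν0.le) (hS.slackCost_nonneg _)) ⟨0, S.N_pos⟩ (Finset.mem_univ _)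
  have h5 : S.slack ⟨0, S.N_pos⟩ ((p.1, rs), μ) = 0 := by
    by_contra hne
    exact (wsq_pos hS.slackWeight_posDef hne).ne' h4
  have h6 : μ ⟨0, S.N_pos⟩ = S.termInput rs p.1 := by
    rw [slack_apply] at h5
    have h7 := h5.trans (S.termInput_slack rs p.1).symm
    exact sub_left_injective (add_left_injective _ h7)
  refine Prod.ext ?_ h2
  rw [hq, h6, termStep_eq]

theorem isEquilibrium (hS : S.Regular) {r : Fin nz → ℝ} {rs : Fin nz → ℝ}
    (hrs : ∀ v, S.IsProjection r v ↔ v = rs) :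
    IsEquilibrium (S.ClosedLoop r) (S.Gx *ᵥ rs, rs) := by
  obtain ⟨η, hη, hT⟩ := hS.exists_mem_T_of_close
  have h1 : (S.Gx *ᵥ rs, rs) ∈ S.T :=
    hT rs ((hrs rs).2 rfl).1 _ (by simpa using hη.le)
  have h2 : S.termStep rs (S.Gx *ᵥ rs) = S.Gx *ᵥ rs := by
    rw [← sub_eq_zero, hS.termStep_sub]
    simp
  have h3 : ∀ q, S.ClosedLoop r (S.Gx *ᵥ rs, rs) q → q = (S.Gx *ᵥ rs, rs) := fun q hq =>
    (hS.successor_eq_of_mem_T hrs (p := (S.Gx *ᵥ rs, rs)) h1 hq).trans (Prod.ext h2 rfl)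
  refine fun q => ⟨h3 q, ?_⟩
  rintro rfl
  -- Some successor exists, and by `h3` it can only be the equilibrium itself.
  obtain ⟨q, hq⟩ := hS.exists_successor r (p := (S.Gx *ᵥ rs, rs)) ⟨rs, mem_Γ_of_mem_T h1⟩
  have h4 := h3 q hq
  rwa [h4] at hq

theorem exists_mem_T_of_dist_lt (hS : S.Regular) {r : Fin nz → ℝ} {rs : Fin nz → ℝ}
    (hrs : ∀ v, S.IsProjection r v ↔ v = rs) :
    ∃ η : ℝ, 0 < η ∧ ∀ p ∈ Metric.ball (S.Gx *ᵥ rs, rs) η, (p.1, rs) ∈ S.T := by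
  obtain ⟨η, hη, hT⟩ := hS.exists_mem_T_of_close
  refine ⟨η, hη, fun p hp => hT rs ((hrs rs).2 rfl).1 _ ?_⟩
  rw [← dist_eq_norm]
  rw [Metric.mem_ball, Prod.dist_eq] at hp
  exact ((le_max_left _ _).trans_lt hp).le

theorem isLyapunovStable (hS : S.Regular) {r : Fin nz → ℝ} {rs : Fin nz → ℝ}
    (hrs : ∀ v, S.IsProjection r v ↔ v = rs) :
    IsLyapunovStable (S.ClosedLoop r) (S.Gx *ᵥ rs, rs) := by
  intro V hV
  obtain ⟨δ, hδ, hball⟩ := Metric.mem_nhds_iff.1 hV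
  obtain ⟨η, hη, hT⟩ := hS.exists_mem_T_of_dist_lt hrs
  obtain ⟨c, C, hc0, hc1, hC, hdecay⟩ := hS.isSchur.exists_pow_decay
  -- Radius `η` puts the initial state in the terminal set, and `δ / C` compensates the constant in
  -- the decay of `A - BK`. The bound `δ` is for time `0`, when the second coordinate is still the
  -- arbitrary `v₋₁`.
  refine ⟨Metric.ball _ (min (min δ η) (δ / C)), Metric.ball_mem_nhds _ (by positivity),
    fun a ha => ?_⟩
  rw [Metric.mem_ball, lt_min_iff, lt_min_iff] at ha
  obtain ⟨⟨ha1, ha2⟩, ha3⟩ := ha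
  have haT := hT a ha2
  refine ⟨hS.exists_trajectory r ⟨rs, mem_Γ_of_mem_T haT⟩, fun p hp hp0 k => hball ?_⟩
  have h1 : ∀ k, (p k).1 = (S.termStep rs)^[k] a.1 ∧
      p (k + 1) = ((S.termStep rs)^[k + 1] a.1, rs) := by
    intro k
    induction k with
    | zero =>
      have h2 := hS.successor_eq_of_mem_T hrs (by rwa [hp0]) (hp 0)
      exact ⟨by rw [hp0]; rfl, by rw [h2, hp0]; rfl⟩
    | succ k ih =>
      have h2 : (p (k + 1)).1 = (S.termStep rs)^[k + 1] a.1 := by rw [ih.2]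
      refine ⟨h2, ?_⟩
      rw [hS.successor_eq_of_mem_T hrs (by rw [h2]; exact iterate_mem_T haT _) (hp (k + 1)), h2,
        Function.iterate_succ_apply' (S.termStep rs) (k + 1)]
  cases k with
  | zero => rwa [hp0]
  | succ k =>
    rw [(h1 k).2, Metric.mem_ball, Prod.dist_eq, dist_self, max_lt_iff]
    refine ⟨?_, hδ⟩
    rw [dist_eq_norm, hS.iterate_sub]
    have h2 : ‖a.1 - S.Gx *ᵥ rs‖ < δ / C := by
      rw [← dist_eq_norm]
      rw [Prod.dist_eq] at ha3
      exact (le_max_left _ _).trans_lt ha3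
    rw [lt_div_iff₀ hC] at h2
    have h3 : c ^ (k + 1) ≤ 1 := pow_le_one₀ hc0.le hc1.le
    have h4 : 0 ≤ C * ‖a.1 - S.Gx *ᵥ rs‖ := by positivity
    calc _ ≤ C * c ^ (k + 1) * ‖a.1 - S.Gx *ᵥ rs‖ := hdecay _ _
      _ = c ^ (k + 1) * (C * ‖a.1 - S.Gx *ᵥ rs‖) := by ring
      _ ≤ 1 * (C * ‖a.1 - S.Gx *ᵥ rs‖) := by gcongr
      _ < δ := by linarith

/-- A first step already requires a feasible reference. Conversely feasibility recurs and every
trajectory converges; the stored reference plays no role in the transition. -/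
theorem domainOfAttraction_eq (hS : S.Regular) {r : Fin nz → ℝ} {rs : Fin nz → ℝ}
    (hrs : ∀ v, S.IsProjection r v ↔ v = rs) :
    domainOfAttraction (S.ClosedLoop r) (S.Gx *ᵥ rs, rs) = (Prod.fst '' S.Λ) ×ˢ univ := by
  rw [fst_image_Λ]
  ext a
  simp only [mem_prod, mem_univ, and_true, mem_ofPred_eq]
  constructor
  · rintro ⟨⟨p, hp, rfl⟩, -⟩
    exact ⟨_, (hp 0).1.1.2⟩
  · intro ha
    exact ⟨hS.exists_trajectory r ha, fun p hp _ => hS.tendsto_of_trajectory hrs hp⟩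

theorem isAsymptoticallyStable (hS : S.Regular) {r : Fin nz → ℝ} {rs : Fin nz → ℝ}
    (hrs : ∀ v, S.IsProjection r v ↔ v = rs) :
    IsAsymptoticallyStable (S.ClosedLoop r) (S.Gx *ᵥ rs, rs) := by
  refine ⟨hS.isEquilibrium hrs, hS.isLyapunovStable hrs, ?_⟩
  obtain ⟨η, hη, hT⟩ := hS.exists_mem_T_of_dist_lt hrs
  rw [hS.domainOfAttraction_eq hrs, fst_image_Λ]
  exact mem_of_superset (Metric.ball_mem_nhds _ hη)
    fun p hp => ⟨⟨rs, mem_Γ_of_mem_T (hT p hp)⟩, mem_univ _⟩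

end Regular

/-! ### The steady-state equation and the main theorem -/

theorem IsEquilibriumBasis.equilibrium (hG : S.IsEquilibriumBasis) :
    S.A * S.Gx + S.B * S.Gu = S.Gx := by
  ext i j
  have h1 : S.Z *ᵥ S.G.col j = 0 := by
    have h2 : S.G.col j ∈ LinearMap.ker S.Z.mulVecLin := by
      rw [← hG.2]
      exact Submodule.subset_span ⟨j, rfl⟩
    simpa using h2
  have h3 := congrFun h1 (Sum.inl i)
  have h4 : (S.Z *ᵥ S.G.col j) (Sum.inl i) = (S.Z * S.G) (Sum.inl i) j := rfl
  rw [h4, Z, G, fromBlocks_mul_fromRows] at h3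
  simp only [fromRows_apply_inl, fromCols_mul_fromRows, Matrix.zero_mul, add_zero,
    Matrix.sub_mul, Matrix.one_mul, Pi.zero_apply, Matrix.add_apply, Matrix.sub_apply] at h3
  rw [Matrix.add_apply]
  linarith

end Data

end FeasGov

theorem theorem3 {nx nu ny nz nc : ℕ} (S : FeasGov.Data nx nu ny nz nc) (r : Fin nz → ℝ)
    (hε : S.ε ∈ Set.Ioo (0 : ℝ) 1)
    (hG : S.IsEquilibriumBasis)
    (hStab : FeasGov.Stabilizable S.A S.B)
    (hGz : IsUnit S.Gz)
    (hYcompact : IsCompact S.Y) (hYint : (0 : Fin ny → ℝ) ∈ interior S.Y)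
    (hQ : S.Q.PosSemidef) (hDet : FeasGov.Detectable S.A S.Q) (hR : S.R.PosDef)
    (hP : S.IsRiccatiSolution) :
    (∀ x v, (x, v) ∈ S.Γ → ∃! μ, S.IsOCPMinimizer x v μ) ∧
    (∀ x ∈ Prod.fst '' S.Λ, ∃! v, S.IsGovernorOutput r x v) ∧
    ∃ rs : Fin nz → ℝ, (∀ v, S.IsProjection r v ↔ v = rs) ∧
      FeasGov.IsAsymptoticallyStable (S.ClosedLoop r) (S.Gx *ᵥ rs, rs) ∧
      FeasGov.domainOfAttraction (S.ClosedLoop r) (S.Gx *ᵥ rs, rs) =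
        (Prod.fst '' S.Λ) ×ˢ Set.univ := by
  have hS : S.Regular := ⟨hε, hG.equilibrium, hYcompact, hYint, hQ, hR, hP, hDet⟩
  refine ⟨fun x v h => hS.existsUnique_minimizer h, fun x hx => ?_, ?_⟩
  · rw [FeasGov.Data.fst_image_Λ] at hx
    exact hS.existsUnique_governorOutput r hx
  · obtain ⟨rs, hrs, huniq⟩ := hS.existsUnique_projection r
    have h : ∀ v, S.IsProjection r v ↔ v = rs := fun v => ⟨huniq v, fun hv => hv ▸ hrs⟩
    exact ⟨rs, h, hS.isAsymptoticallyStable h, hS.domainOfAttraction_eq h⟩
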